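/- **Setting.** An oracle is a function $O:\{0,1\}^*\to\{0,1\}^*$. A description $C$ of an oracle-aided quantum circuit is a bit string encoding (with a fixed prefix-free encoding in which wire numbers are written in unary) two register sizes $n_A,n_B$ and a list of gates on $n_A+n_B$ qubits from $\{\mathrm{NOT},H,T,\mathrm{CNOT},\mathrm{Toffoli}\}$ and oracle gates. An oracle gate has query wires and response wires and maps $|x\rangle|z\rangle\mapsto|x\rangle|z\oplus \overline{O(x)}\rangle$, where $\overline{O(x)}$ is $O(x)$ followed by a $1$ and then $0$'s, cut to the number of response wires. For a valid description write $C^O|0\rangle=\sum_s\sqrt{p_s}\,|s\rangle_A|\psi_s\rangle_B$ with $p_s\ge 0$ and unit vectors $\psi_s$, and let $|\psi^O_C\rangle=\sum_s\sqrt{p_s}\,|s\rangle|\psi_s\rangle|\psi_s\rangle$; if the string $C$ is not a valid description, let $|\psi_C^O\rangle=|\bot\rangle$. Let $\mathsf{DCol}^O_C$ be the distribution of the result of measuring $|\psi^O_C\rangle$ in the computational basis, and $\mathsf{DCol}^O=\bigotimes_C\mathsf{DCol}^O_C$. The compression unitary of a product distribution $\bigotimes_x D_x$ is $\sum_x|x\rangle\langle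 x|\otimes U_x$ with $$U_x=|D_x\rangle\langle\bot|+|\bot\rangle\langle D_x|+\bigl(I-|\bot\rangle\langle\bot|-|D_x\rangle\langle D_x|\bigr),\qquad |D_x\rangle=\sum_z\sqrt{\Pr_{D_x}[z]}\,|z\rangle .$$ Let $W^O$ be the compression unitary of $\mathsf{DCol}^O$. A $q$-query algorithm makes at most $q$ quantum queries, each of length at most $q$. A collection of unitaries $\{W_O\}_{O\in\mathbb O}$ is *OW2H-compatible* for $\mathbb O$ with constant $c$ if 1. there is an algorithm, not depending on $O$, that on every input $x$ makes a single query to $W_O$ and outputs $O(x)$ with probability $1$, for all $O\in\mathbb O$; 2. there are polynomials $p,r$ such that for every $q:\mathbb N\to\mathbb N$ there is a $p(q(\lambda))$-query algorithm $\mathcal B$ (with query access to $\mathcal A$ and to $W_O$, both kinds of queries being counted, and with output of length at most $p(q(\lambda))$) such that for all $O,O'\in\mathbb O$, all $q(\lambda)$-query algorithms $\mathcal A$ and all $\lambda$, $$\bigl\||\psi\rangle-|\psi'\rangle\bigr\|\le r(q(\lambda))\cdot\Pr\bigl[\mathcal B^{W_O,\mathcal A}(1^\lambda)\in T\bigr]^{c},$$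 where $|\psi\rangle,|\psi'\rangle$ are the purified final states of $\mathcal A^{W_O}(1^\lambda)$ and $\mathcal A^{W_{O'}}(1^\lambda)$, and $T=\{x:O(x)\ne O'(x)\}$. **Theorem.** Let $\mathbb O$ be any set of oracles such that for every $x$ the lengths of the answers $O(x)$, $O\in\mathbb O$, are bounded. Then each $W^O$, $O\in\mathbb O$, is unitary, and $\{W^O\}_{O\in\mathbb O}$ is OW2H-compatible for $\mathbb O$ with $c=1/4$. Moreover, the bound in (2) holds (for a suitable polynomial $p$ and suitable $\mathcal B$) in the form $$\bigl\||\psi\rangle-|\psi'\rangle\bigr\|\le 4\sqrt6\;q(\lambda)^{5/4}\,\Pr\bigl[\mathcal B^{W^O,\mathcal A}(1^\lambda)\in T\bigr]^{1/4}.$$ -/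

import Mathlib

noncomputable section

/-! ### Strings, oracles, quantum registers -/

/-- Bit strings. -/
abbrev Str := List Bool

/-- A classical oracle: a function from bit strings to bit strings. -/
abbrev Oracle := Str → Str

/-- The Hilbert space `ℓ²(ι)` with computational basis `ι`. -/
abbrev Ket (ι : Type) := lp (fun _ : ι => ℂ) 2

open Classical in
/-- The computational basis vector `|i⟩`. -/
def ket {ι : Type} (i : ι) : Ket ι := lp.single 2 i (1 : ℂ)

theorem memlp_two_iff {ι : Type} {f : ι → ℂ} :
    Memℓp f 2 ↔ Summable (fun i => ‖f i‖ ^ 2) := by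
  rw [memℓp_gen_iff (by norm_num)]
  norm_num

theorem ket_summable {ι : Type} (f : Ket ι) : Summable (fun i => ‖f i‖ ^ 2) :=
  memlp_two_iff.1 (lp.memℓp f)

theorem ket_norm_sq {ι : Type} (f : Ket ι) : ‖f‖ ^ 2 = ∑' i, ‖f i‖ ^ 2 := by
  have := lp.norm_rpow_eq_tsum (p := 2) (by norm_num) f
  norm_num at this
  exact this

theorem orthonormal_ket {ι τ : Type} {f : τ → ι} (hf : Function.Injective f) :
    Orthonormal ℂ (fun t => ket (f t)) := by
  classical
  rw [orthonormal_iff_ite]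
  intro i j
  simp only [ket]
  rw [lp.inner_single_left]
  by_cases h : i = j
  · subst h; simp
  · have h' : f i ≠ f j := fun e => h (hf e)
    simp [h, h']

theorem norm_ket {ι : Type} (i : ι) : ‖ket i‖ = 1 :=
  (orthonormal_ket (f := fun _ : Unit => i) (fun _ _ _ => rfl)).1 ()

theorem norm_sq_sum_ket {ι τ : Type} [Fintype τ] {f : τ → ι} (hf : Function.Injective f)
    (a : τ → ℂ) : ‖∑ t, a t • ket (f t)‖ ^ 2 = ∑ t, ‖a t‖ ^ 2 := by
  have h := (orthonormal_ket hf).inner_sum a a Finset.univ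
  have h2 := inner_self_eq_norm_sq_to_K (𝕜 := ℂ) (∑ t, a t • ket (f t))
  rw [h2] at h
  have h3 : ((‖∑ t, a t • ket (f t)‖ ^ 2 : ℝ) : ℂ) = ((∑ t, ‖a t‖ ^ 2 : ℝ) : ℂ) := by
    push_cast
    refine h.trans (Finset.sum_congr rfl fun t _ => ?_)
    exact RCLike.conj_mul (a t)
  exact_mod_cast h3

/-- The restriction of `f ∈ ℓ²(β × α)` to the block `b`, for `κ ≃ β × α`. -/
def blockAt {κ β α : Type} (e : κ ≃ β × α) (f : Ket κ) (b : β) : Ket α :=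
  ⟨fun a => f (e.symm (b, a)), memlp_two_iff.2 ((ket_summable f).comp_injective
    (i := fun a => e.symm (b, a)) (fun a a' h => by simpa using h))⟩

theorem blockAt_apply {κ β α : Type} (e : κ ≃ β × α) (f : Ket κ) (b : β) (a : α) :
    blockAt e f b a = f (e.symm (b, a)) := rfl

theorem hasSum_blockAt {κ β α : Type} (e : κ ≃ β × α) (f : Ket κ) :
    HasSum (fun b => ‖blockAt e f b‖ ^ 2) (‖f‖ ^ 2) := by
  have h : HasSum (fun p : β × α => ‖f (e.symm p)‖ ^ 2) (‖f‖ ^ 2) := by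
    rw [ket_norm_sq]
    exact (Equiv.hasSum_iff e.symm (f := fun k => ‖f k‖ ^ 2)).2 (ket_summable f).hasSum
  refine h.prod_fiberwise fun b => ?_
  rw [ket_norm_sq]
  exact (ket_summable (blockAt e f b)).hasSum

theorem summable_blockOp {κ β α : Type} (e : κ ≃ β × α) (T : β → Ket α →L[ℂ] Ket α) (M : ℝ)
    (hM : ∀ b, ‖T b‖ ≤ M) (f : Ket κ) :
    Summable (fun p : β × α => ‖T p.1 (blockAt e f p.1) p.2‖ ^ 2) ∧
      ∑' p : β × α, ‖T p.1 (blockAt e f p.1) p.2‖ ^ 2 ≤ (|M| * ‖f‖) ^ 2 := by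
  have hb : ∀ b, ‖T b (blockAt e f b)‖ ^ 2 ≤ |M| ^ 2 * ‖blockAt e f b‖ ^ 2 := by
    intro b
    rw [← mul_pow]
    exact pow_le_pow_left₀ (norm_nonneg _)
      ((T b).le_of_opNorm_le ((hM b).trans (le_abs_self M)) _) 2
  have hs := (hasSum_blockAt e f).mul_left (|M| ^ 2)
  have hs' : Summable (fun b => ‖T b (blockAt e f b)‖ ^ 2) :=
    Summable.of_nonneg_of_le (fun _ => sq_nonneg _) hb hs.summable
  have h1 : Summable (fun p : β × α => ‖T p.1 (blockAt e f p.1) p.2‖ ^ 2) := by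
    refine (summable_prod_of_nonneg (fun _ => sq_nonneg _)).2
      ⟨fun b => ket_summable (T b (blockAt e f b)), ?_⟩
    exact hs'.congr fun b => ket_norm_sq (T b (blockAt e f b))
  refine ⟨h1, ?_⟩
  have h2 : ∑' p : β × α, ‖T p.1 (blockAt e f p.1) p.2‖ ^ 2 =
      ∑' b, ‖T b (blockAt e f b)‖ ^ 2 :=
    h1.tsum_prod.trans (tsum_congr fun b => (ket_norm_sq (T b (blockAt e f b))).symm)
  rw [h2, mul_pow, ← hs.tsum_eq]
  exact hs'.tsum_le_tsum hb hs.summable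

/-- The block operator `∑_b |b⟩⟨b| ⊗ T_b` on `ℓ²(κ)`, where `e : κ ≃ β × α` splits the
registers into a control part `β` and a target part `α` (and `M` bounds the `‖T_b‖`). -/
def blockOp {κ β α : Type} (e : κ ≃ β × α) (T : β → Ket α →L[ℂ] Ket α) (M : ℝ)
    (hM : ∀ b, ‖T b‖ ≤ M) : Ket κ →L[ℂ] Ket κ :=
  LinearMap.mkContinuous
    { toFun := fun f => ⟨fun k => T (e k).1 (blockAt e f (e k).1) (e k).2, memlp_two_iff.2
        ((Equiv.summable_iff e).2 (summable_blockOp e T M hM f).1)⟩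
      map_add' := fun f g => by
        ext k
        have : blockAt e (f + g) (e k).1 = blockAt e f (e k).1 + blockAt e g (e k).1 := rfl
        simp only [this, map_add]
        rfl
      map_smul' := fun c f => by
        ext k
        have : blockAt e (c • f) (e k).1 = c • blockAt e f (e k).1 := rfl
        simp only [this, map_smul]
        rfl }
    |M| fun f => by
      refine le_of_sq_le_sq ?_ (by positivity)
      rw [ket_norm_sq]
      refine le_trans (le_of_eq ?_) (summable_blockOp e T M hM f).2
      exact Equiv.tsum_eq e (fun p : β × α => ‖T p.1 (blockAt e f p.1) p.2‖ ^ 2)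

theorem blockOp_apply {κ β α : Type} (e : κ ≃ β × α) (T : β → Ket α →L[ℂ] Ket α) (M : ℝ)
    (hM : ∀ b, ‖T b‖ ≤ M) (f : Ket κ) (k : κ) :
    blockOp e T M hM f k = T (e k).1 (blockAt e f (e k).1) (e k).2 := rfl

/-- `T` applied to the registers `α` of a system with registers `κ ≃ β × α`: `1_β ⊗ T`. -/
def actOn {κ β α : Type} (e : κ ≃ β × α) (T : Ket α →L[ℂ] Ket α) : Ket κ →L[ℂ] Ket κ :=
  blockOp e (fun _ => T) ‖T‖ fun _ => le_rfl

/-- The probability that a computational basis measurement of `ψ` gives a result in `S`. -/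
def probIn {κ : Type} (ψ : Ket κ) (S : Set κ) : ℝ :=
  ∑' k, S.indicator (fun k => ‖ψ k‖ ^ 2) k

/-- The distribution of the result of measuring a unit vector in the computational basis. -/
def measureDist {ι : Type} (ψ : Ket ι) (h : ‖ψ‖ = 1) : PMF ι :=
  ⟨fun i => ENNReal.ofReal (‖ψ i‖ ^ 2), by
    have h1 : ∑' i, ‖ψ i‖ ^ 2 = 1 := by rw [← ket_norm_sq, h, one_pow]
    have h2 := (ENNReal.ofReal_tsum_of_nonneg (fun i => by positivity) (ket_summable ψ)).symm
    rw [h1, ENNReal.ofReal_one] at h2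
    exact h2 ▸ ENNReal.summable.hasSum⟩

/-! ### Compression unitaries -/

/-- The vector `|D⟩ = ∑_z √Pr_D[z] |z⟩` of a distribution `D`. -/
def distKet {ι : Type} (D : PMF ι) : Ket ι :=
  ⟨fun z => ((Real.sqrt (D z).toReal : ℝ) : ℂ), memlp_two_iff.2 (by
    have h : Summable fun z => (D z).toReal := ENNReal.summable_toReal D.tsum_coe_ne_top
    simpa [abs_of_nonneg, Real.sqrt_nonneg, Real.sq_sqrt] using h)⟩

theorem norm_distKet {ι : Type} (D : PMF ι) : ‖distKet D‖ = 1 := by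
  have h : ‖distKet D‖ ^ 2 = 1 := by
    rw [ket_norm_sq]
    have h1 : ∀ z, ‖distKet D z‖ ^ 2 = (D z).toReal := fun z => by
      simp [distKet, abs_of_nonneg, Real.sqrt_nonneg, Real.sq_sqrt]
    simp only [h1]
    rw [← ENNReal.tsum_toReal_eq (fun z => D.apply_ne_top z), D.tsum_coe, ENNReal.toReal_one]
  exact (pow_eq_one_iff_of_nonneg (norm_nonneg _) two_ne_zero).1 h

/-- The basis of a response register: strings, and the extra symbol `⊥`, which is `none`. -/
abbrev Resp := Option Str

/-- The basis of a query register together with its response register. -/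
abbrev QIn := Str × Resp

/-- `|φ⟩⟨⊥| + |⊥⟩⟨φ| + (1 - |⊥⟩⟨⊥| - |φ⟩⟨φ|)`, the swap of `|⊥⟩` and `|φ⟩`. -/
def swapBot (φ : Ket Resp) : Ket Resp →L[ℂ] Ket Resp :=
  InnerProductSpace.rankOne ℂ φ (ket none) + InnerProductSpace.rankOne ℂ (ket none) φ +
    (1 - InnerProductSpace.rankOne ℂ (ket none) (ket none) - InnerProductSpace.rankOne ℂ φ φ)

theorem norm_swapBot_le (φ : Ket Resp) (h : ‖φ‖ = 1) : ‖swapBot φ‖ ≤ 5 := by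
  have hr : ∀ a b : Ket Resp, ‖a‖ = 1 → ‖b‖ = 1 → ‖InnerProductSpace.rankOne ℂ a b‖ = 1 := by
    intro a b ha hb
    rw [InnerProductSpace.norm_rankOne, ha, hb, one_mul]
  have hb := norm_ket (none : Resp)
  have h1 : ‖(1 : Ket Resp →L[ℂ] Ket Resp)‖ ≤ 1 := ContinuousLinearMap.norm_id_le
  have e1 := norm_add_le
    (InnerProductSpace.rankOne ℂ φ (ket none) + InnerProductSpace.rankOne ℂ (ket none) φ)
    (1 - InnerProductSpace.rankOne ℂ (ket none) (ket none) - InnerProductSpace.rankOne ℂ φ φ)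
  have e2 := norm_add_le (InnerProductSpace.rankOne ℂ φ (ket none : Ket Resp))
    (InnerProductSpace.rankOne ℂ (ket none) φ)
  have e3 := norm_sub_le (1 - InnerProductSpace.rankOne ℂ (ket none : Ket Resp) (ket none))
    (InnerProductSpace.rankOne ℂ φ φ)
  have e4 := norm_sub_le (1 : Ket Resp →L[ℂ] Ket Resp) (InnerProductSpace.rankOne ℂ (ket none : Ket Resp) (ket none))
  rw [hr _ _ h hb, hr _ _ hb h] at e2
  rw [hr _ _ h h] at e3
  rw [hr _ _ hb hb] at e4
  unfold swapBot
  linarith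

/-- The compression unitary `∑_x |x⟩⟨x| ⊗ U_x` of the product distribution of the `D_x`, where
`U_x` swaps `|⊥⟩` and `|D_x⟩`. -/
def compressionUnitary (D : Str → PMF Resp) : Ket QIn →L[ℂ] Ket QIn :=
  blockOp (Equiv.refl (Str × Resp)) (fun x => swapBot (distKet (D x))) 5
    fun x => norm_swapBot_le _ (norm_distKet (D x))

/-! ### Oracle-aided quantum circuits -/

/-- The gates on `n` qubits: NOT, Hadamard, `T = diag(1, e^{iπ/4})`, CNOT (control first),
Toffoli (target last), and the oracle gate with query wires `ins` and response wires `outs`. -/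
inductive Gate (n : ℕ) : Type
  | not (t : Fin n)
  | had (t : Fin n)
  | tee (t : Fin n)
  | cnot (c t : Fin n) (h : c ≠ t)
  | toffoli (c d t : Fin n) (h : c ≠ t ∧ d ≠ t ∧ c ≠ d)
  | oracle (ins outs : List (Fin n)) (h : (ins ++ outs).Nodup)

/-- Bit number `j` of the answer `y` of an oracle on response wires: the bits of `y`, then a `1`
that marks the end, then zeros. (On `|y|` response wires these are just the bits of `y`.) -/
def answerBit (y : Str) (j : ℕ) : Bool := (y ++ [true]).getD j false

/-- The map `|x⟩|z⟩ ↦ |x⟩|z ⊕ O(x)⟩` on basis states, `x` on the wires `ins`, `z` on `outs`. -/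
def oracleFlip {n : ℕ} (O : Oracle) (ins outs : List (Fin n)) (b : Fin n → Bool) : Fin n → Bool :=
  fun w => if w ∈ outs then xor (b w) (answerBit (O (ins.map b)) (outs.idxOf w)) else b w

/-- The action of a gate on a vector of amplitudes. (NOT, CNOT, Toffoli and the oracle gate
permute the basis states by involutions.) -/
def Gate.apply {n : ℕ} (O : Oracle) :
    Gate n → ((Fin n → Bool) → ℂ) → ((Fin n → Bool) → ℂ)
  | .not t, ψ => fun b => ψ (Function.update b t (!b t))
  | .had t, ψ => fun b => (Real.sqrt 2 : ℂ)⁻¹ * (ψ (Function.update b t false) +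
      (if b t then -1 else 1) * ψ (Function.update b t true))
  | .tee t, ψ => fun b => (if b t then Complex.exp (Complex.I * (Real.pi / 4)) else 1) * ψ b
  | .cnot c t _, ψ => fun b => ψ (Function.update b t (xor (b t) (b c)))
  | .toffoli c d t _, ψ => fun b => ψ (Function.update b t (xor (b t) (b c && b d)))
  | .oracle ins outs _, ψ => fun b => ψ (oracleFlip O ins outs b)

theorem sum_norm_sq_invol {β : Type} [Fintype β] (f : β → β) (hf : Function.Involutive f)
    (ψ : β → ℂ) : ∑ b, ‖ψ (f b)‖ ^ 2 = ∑ b, ‖ψ b‖ ^ 2 :=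
  Equiv.sum_comp hf.toPerm (fun b => ‖ψ b‖ ^ 2)

theorem oracleFlip_involutive {n : ℕ} (O : Oracle) (ins outs : List (Fin n))
    (h : (ins ++ outs).Nodup) : Function.Involutive (oracleFlip O ins outs) := by
  intro b
  have hins : ins.map (oracleFlip O ins outs b) = ins.map b := by
    refine List.map_congr_left fun w hw => ?_
    have : w ∉ outs := fun h' => (List.disjoint_of_nodup_append h) hw h'
    simp [oracleFlip, this]
  funext w
  by_cases hw : w ∈ outs
  · have h1 : oracleFlip O ins outs b w =
        xor (b w) (answerBit (O (ins.map b)) (outs.idxOf w)) := by simp [oracleFlip, hw]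
    rw [oracleFlip, if_pos hw, hins, h1]
    simp
  · simp [oracleFlip, hw]

theorem Gate.sum_norm_sq_apply {n : ℕ} (O : Oracle) (g : Gate n) (ψ : (Fin n → Bool) → ℂ) :
    ∑ b, ‖g.apply O ψ b‖ ^ 2 = ∑ b, ‖ψ b‖ ^ 2 := by
  cases g with
  | not t =>
    have h0 := sum_norm_sq_invol (fun b => Function.update b t (!b t)) (fun b => by simp) ψ
    simpa only [Gate.apply] using h0
  | had t =>
    have hinv : Function.Involutive (fun b : Fin n → Bool => Function.update b t (!b t)) :=
      fun b => by simp
    have key : ∀ b : Fin n → Bool,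
        ‖(Gate.had t).apply O ψ b‖ ^ 2 +
          ‖(Gate.had t).apply O ψ (Function.update b t (!b t))‖ ^ 2 =
        ‖ψ b‖ ^ 2 + ‖ψ (Function.update b t (!b t))‖ ^ 2 := by
      intro b
      have hpar := fun x y : ℂ => parallelogram_law_with_norm ℝ x y
      have h2 : ‖(Real.sqrt 2 : ℂ)⁻¹‖ ^ 2 = 1 / 2 := by
        rw [norm_inv, Complex.norm_real, Real.norm_of_nonneg (Real.sqrt_nonneg 2), inv_pow,
          Real.sq_sqrt (by norm_num)]
        norm_num
      cases hb : b t with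
      | false =>
        have hu : Function.update b t false = b := by rw [← hb]; simp
        simp only [Gate.apply, hb, hu, Bool.not_false, Function.update_self,
          Function.update_idem, Bool.false_eq_true, if_true, if_false, one_mul, neg_one_mul,
          norm_mul, mul_pow, h2]
        have := hpar (ψ b) (ψ (Function.update b t true))
        rw [← sub_eq_add_neg]
        nlinarith [this]
      | true =>
        have hu : Function.update b t true = b := by rw [← hb]; simp
        simp only [Gate.apply, hb, hu, Bool.not_true, Function.update_self,
          Function.update_idem, Bool.false_eq_true, if_true, if_false, one_mul, neg_one_mul,
          norm_mul, mul_pow, h2]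
        have := hpar (ψ (Function.update b t false)) (ψ b)
        rw [← sub_eq_add_neg]
        nlinarith [this]
    have hs := Finset.sum_congr (rfl : (Finset.univ : Finset (Fin n → Bool)) = Finset.univ)
      (fun b _ => key b)
    rw [Finset.sum_add_distrib, Finset.sum_add_distrib, sum_norm_sq_invol _ hinv ψ,
      sum_norm_sq_invol _ hinv ((Gate.had t).apply O ψ)] at hs
    linarith
  | tee t =>
    refine Finset.sum_congr rfl fun b _ => ?_
    have h1 : ‖(if b t then Complex.exp (Complex.I * (Real.pi / 4)) else 1 : ℂ)‖ = 1 := by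
      split_ifs
      · have : Complex.I * (Real.pi / 4) = ((Real.pi / 4 : ℝ) : ℂ) * Complex.I := by
          push_cast; ring
        rw [this, Complex.norm_exp_ofReal_mul_I]
      · simp
    simp only [Gate.apply, norm_mul, h1, one_mul]
  | cnot c t h =>
    have h0 := sum_norm_sq_invol (fun b => Function.update b t (xor (b t) (b c)))
      (fun b => by simp [Function.update_of_ne h]) ψ
    simpa only [Gate.apply] using h0
  | toffoli c d t h =>
    have h0 := sum_norm_sq_invol (fun b => Function.update b t (xor (b t) (b c && b d)))
      (fun b => by simp [Function.update_of_ne h.1, Function.update_of_ne h.2.1]) ψ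
    simpa only [Gate.apply] using h0
  | oracle ins outs h =>
    have h0 := sum_norm_sq_invol (oracleFlip O ins outs) (oracleFlip_involutive O ins outs h) ψ
    simpa only [Gate.apply] using h0

/-- An oracle-aided circuit with two output registers: `A`, the first `nA` wires, and `B`, the
other `nB` wires. -/
structure Circuit where
  nA : ℕ
  nB : ℕ
  gates : List (Gate (nA + nB))

/-- The amplitudes of the final state `C^O|0⟩`. -/
def Circuit.final (C : Circuit) (O : Oracle) : (Fin (C.nA + C.nB) → Bool) → ℂ :=
  C.gates.foldl (fun ψ g => g.apply O ψ) (Pi.single (fun _ => false) 1)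

theorem Circuit.sum_norm_sq_final (C : Circuit) (O : Oracle) :
    ∑ b, ‖C.final O b‖ ^ 2 = 1 := by
  have h : ∀ (l : List (Gate (C.nA + C.nB))) (ψ : (Fin (C.nA + C.nB) → Bool) → ℂ),
      ∑ b, ‖l.foldl (fun ψ g => g.apply O ψ) ψ b‖ ^ 2 = ∑ b, ‖ψ b‖ ^ 2 := by
    intro l
    induction l with
    | nil => intro ψ; rfl
    | cons g l ih => intro ψ; rw [List.foldl_cons, ih, Gate.sum_norm_sq_apply]
  rw [Circuit.final, h, Finset.sum_eq_single (fun _ => false)]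
  · simp
  · intro b _ hb
    simp [hb]
  · simp

/-! ### Descriptions of circuits by strings -/

/-- Prefix-free unary code of a number. -/
def encNat (n : ℕ) : Str := List.replicate n true ++ [false]

/-- Prefix-free code of a list whose entries have prefix-free codes. -/
def encList {γ : Type} (enc : γ → Str) : List γ → Str
  | [] => [false]
  | a :: l => true :: (enc a ++ encList enc l)

def Gate.encode {n : ℕ} : Gate n → Str
  | .not t => encNat 0 ++ encNat t
  | .had t => encNat 1 ++ encNat t
  | .tee t => encNat 2 ++ encNat t
  | .cnot c t _ => encNat 3 ++ (encNat c ++ encNat t)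
  | .toffoli c d t _ => encNat 4 ++ (encNat c ++ (encNat d ++ encNat t))
  | .oracle ins outs _ => encNat 5 ++
      (encList (fun i : Fin n => encNat i) ins ++ encList (fun i : Fin n => encNat i) outs)

def Circuit.encode (C : Circuit) : Str :=
  encNat C.nA ++ (encNat C.nB ++ encList Gate.encode C.gates)

theorem encNat_append {m n : ℕ} {s t : Str} (h : encNat m ++ s = encNat n ++ t) :
    m = n ∧ s = t := by
  induction m generalizing n with
  | zero => cases n with
    | zero => simpa [encNat] using h
    | succ n => simp [encNat, List.replicate_succ] at h
  | succ m ih => cases n with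
    | zero => simp [encNat, List.replicate_succ] at h
    | succ n =>
      have := ih (n := n) (by simpa [encNat, List.replicate_succ] using h)
      exact ⟨by rw [this.1], this.2⟩

theorem encFin_append {k : ℕ} {m n : Fin k} {s t : Str}
    (h : encNat m ++ s = encNat n ++ t) : m = n ∧ s = t :=
  ⟨Fin.ext (encNat_append h).1, (encNat_append h).2⟩

theorem encList_append {γ : Type} {enc : γ → Str}
    (henc : ∀ a b s t, enc a ++ s = enc b ++ t → a = b ∧ s = t) {l l' : List γ} {s t : Str}
    (h : encList enc l ++ s = encList enc l' ++ t) : l = l' ∧ s = t := by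
  induction l generalizing l' with
  | nil => cases l' with
    | nil => simpa [encList] using h
    | cons b l' => simp [encList] at h
  | cons a l ih => cases l' with
    | nil => simp [encList] at h
    | cons b l' =>
      simp only [encList, List.cons_append, List.cons.injEq, true_and, List.append_assoc] at h
      obtain ⟨rfl, h'⟩ := henc _ _ _ _ h
      obtain ⟨rfl, h''⟩ := ih h'
      exact ⟨rfl, h''⟩

theorem Gate.encode_append {n : ℕ} (g g' : Gate n) (s t : Str)
    (h : g.encode ++ s = g'.encode ++ t) : g = g' ∧ s = t := by
  have hl : ∀ {l l' : List (Fin n)} {s t : Str},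
      encList (fun i : Fin n => encNat i) l ++ s = encList (fun i : Fin n => encNat i) l' ++ t →
        l = l' ∧ s = t :=
    fun h => encList_append (fun _ _ _ _ => encFin_append) h
  cases g <;> cases g' <;> simp only [Gate.encode, List.append_assoc] at h <;>
    obtain ⟨h0, h⟩ := encNat_append h <;> try omega
  · obtain ⟨h1, h2⟩ := encFin_append h
    simp [h1, h2]
  · obtain ⟨h1, h2⟩ := encFin_append h
    simp [h1, h2]
  · obtain ⟨h1, h2⟩ := encFin_append h
    simp [h1, h2]
  · obtain ⟨h1, h⟩ := encFin_append h
    obtain ⟨h2, h3⟩ := encFin_append h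
    simp [h1, h2, h3]
  · obtain ⟨h1, h⟩ := encFin_append h
    obtain ⟨h2, h⟩ := encFin_append h
    obtain ⟨h3, h4⟩ := encFin_append h
    simp [h1, h2, h3, h4]
  · obtain ⟨h1, h⟩ := hl h
    obtain ⟨h2, h3⟩ := hl h
    simp [h1, h2, h3]

theorem Circuit.encode_injective : Function.Injective Circuit.encode := by
  rintro ⟨a, b, l⟩ ⟨a', b', l'⟩ h
  obtain ⟨h1, h⟩ := encNat_append h
  obtain ⟨h2, h⟩ := encNat_append h
  simp only at h1 h2
  subst h1 h2
  have := encList_append (s := []) (t := []) Gate.encode_append (by simpa using h)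
  rw [this.1]

open Classical in
/-- The circuit that a string describes, if it describes one. -/
def Circuit.decode (x : Str) : Option Circuit :=
  if h : ∃ C : Circuit, C.encode = x then some h.choose else none

theorem Circuit.decode_encode (C : Circuit) : Circuit.decode C.encode = some C := by
  have h : ∃ C' : Circuit, C'.encode = C.encode := ⟨C, rfl⟩
  rw [Circuit.decode, dif_pos h]
  exact congrArg some (Circuit.encode_injective h.choose_spec)

/-! ### The collision-finding distributions -/

/-- The amplitude `√p_s ⟨b|ψ_s⟩` of `|s⟩_A |b⟩_B` in `C^O|0⟩ = ∑_s √p_s |s⟩_A |ψ_s⟩_B`. -/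
def Circuit.amp (C : Circuit) (O : Oracle) (s : Fin C.nA → Bool) (b : Fin C.nB → Bool) : ℂ :=
  C.final O (Fin.append s b)

/-- The probability `p_s` of the outcome `s` of measuring `A`. -/
def Circuit.prob (C : Circuit) (O : Oracle) (s : Fin C.nA → Bool) : ℝ :=
  ∑ b, ‖C.amp O s b‖ ^ 2

/-- The amplitude `⟨b|ψ_s⟩` of the normalized residual state on `B` (used only if `p_s ≠ 0`). -/
def Circuit.residual (C : Circuit) (O : Oracle) (s : Fin C.nA → Bool) (b : Fin C.nB → Bool) : ℂ :=
  C.amp O s b / (Real.sqrt (C.prob O s) : ℂ)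

/-- The string `s‖b‖b'`. -/
def Circuit.tripleStr (C : Circuit)
    (t : (Fin C.nA → Bool) × (Fin C.nB → Bool) × (Fin C.nB → Bool)) : Str :=
  List.ofFn t.1 ++ (List.ofFn t.2.1 ++ List.ofFn t.2.2)

/-- The vector `∑_s √p_s |s⟩|ψ_s⟩|ψ_s⟩`. -/
def Circuit.doubled (C : Circuit) (O : Oracle) : Ket Resp :=
  ∑ t : (Fin C.nA → Bool) × (Fin C.nB → Bool) × (Fin C.nB → Bool),
    ((Real.sqrt (C.prob O t.1) : ℂ) * (C.residual O t.1 t.2.1 * C.residual O t.1 t.2.2)) •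
      ket (some (C.tripleStr t))

theorem Circuit.tripleStr_injective (C : Circuit) : Function.Injective C.tripleStr := by
  rintro ⟨s, b, b'⟩ ⟨s', c, c'⟩ h
  obtain ⟨h1, h⟩ := List.append_inj h (by simp)
  obtain ⟨h2, h3⟩ := List.append_inj h (by simp)
  exact Prod.ext (List.ofFn_injective h1)
    (Prod.ext (List.ofFn_injective h2) (List.ofFn_injective h3))

theorem Circuit.sum_prob (C : Circuit) (O : Oracle) : ∑ s, C.prob O s = 1 := by
  rw [← C.sum_norm_sq_final O, ← Equiv.sum_comp (Fin.appendEquiv C.nA C.nB),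
    Fintype.sum_prod_type]
  rfl

theorem Circuit.norm_doubled (C : Circuit) (O : Oracle) : ‖C.doubled O‖ = 1 := by
  have h : ‖C.doubled O‖ ^ 2 = 1 := by
    rw [Circuit.doubled,
      norm_sq_sum_ket (f := fun t => some (C.tripleStr t))
        ((Option.some_injective _).comp C.tripleStr_injective),
      ← C.sum_prob O, Fintype.sum_prod_type]
    refine Finset.sum_congr rfl fun s _ => ?_
    have h0 : 0 ≤ C.prob O s := Finset.sum_nonneg fun _ _ => by positivity
    have hr : ∀ b, ‖C.residual O s b‖ ^ 2 = ‖C.amp O s b‖ ^ 2 / C.prob O s := by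
      intro b
      rw [Circuit.residual, norm_div, div_pow, Complex.norm_real,
        Real.norm_of_nonneg (Real.sqrt_nonneg _), Real.sq_sqrt h0]
    have hs : ‖(Real.sqrt (C.prob O s) : ℂ)‖ ^ 2 = C.prob O s := by
      rw [Complex.norm_real, Real.norm_of_nonneg (Real.sqrt_nonneg _), Real.sq_sqrt h0]
    simp only [norm_mul, mul_pow, hr, hs]
    rw [← Finset.mul_sum, Fintype.sum_prod_type]
    simp only [← Finset.mul_sum, ← Finset.sum_mul, ← Finset.sum_div]
    change C.prob O s * (C.prob O s / C.prob O s * (C.prob O s / C.prob O s)) = C.prob O s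
    by_cases hp : C.prob O s = 0
    · simp [hp]
    · field_simp
  exact (pow_eq_one_iff_of_nonneg (norm_nonneg _) two_ne_zero).1 h

/-- The state `|ψ^O_x⟩`: `∑_s √p_s |s⟩|ψ_s⟩|ψ_s⟩` if `x` describes a circuit, `|⊥⟩` otherwise. -/
def colState (O : Oracle) (x : Str) : Ket Resp :=
  match Circuit.decode x with
  | none => ket none
  | some C => C.doubled O

theorem norm_colState (O : Oracle) (x : Str) : ‖colState O x‖ = 1 := by
  unfold colState
  split
  · exact norm_ket _
  · exact Circuit.norm_doubled _ _

/-- The distribution `DCol^O_x`: measure `|ψ^O_x⟩` in the computational basis. -/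
def DCol (O : Oracle) (x : Str) : PMF Resp := measureDist (colState O x) (norm_colState O x)

/-- The compression unitary of the product distribution `DCol^O = ⨂_x DCol^O_x`. -/
def colUnitary (O : Oracle) : Ket QIn →L[ℂ] Ket QIn := compressionUnitary (DCol O)

/-! ### Query algorithms -/

/-- A (purified) algorithm with quantum query access to an operator on `ℓ²(QIn)`. Its registers
are the query and response registers and a workspace. It starts in the basis state
`|empty, ⊥, work0⟩`, applies `step 0`, and then makes `queries` queries, number `i` of which
(counting from `0`) is followed by `step (i + 1)`; later steps are not used. -/
structure QAlg where
  Work : Type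
  work0 : Work
  queries : ℕ
  step : ℕ → (Ket (QIn × Work) ≃ₗᵢ[ℂ] Ket (QIn × Work))

/-- The state right before query number `i` (counting from `0`), if the oracle is `U`. -/
def QAlg.state (A : QAlg) (U : Ket QIn →L[ℂ] Ket QIn) : ℕ → Ket (QIn × A.Work)
  | 0 => A.step 0 (ket (([], none), A.work0))
  | i + 1 => A.step (i + 1) (actOn (Equiv.prodComm QIn A.Work) U (A.state U i))

/-- The final state of `A^U`. -/
def QAlg.final (A : QAlg) (U : Ket QIn →L[ℂ] Ket QIn) : Ket (QIn × A.Work) := A.state U A.queries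

/-- `A` is an `n`-query algorithm for the oracles `𝒰`: at most `n` queries, each of length at
most `n`. -/
def QAlg.IsQuery (A : QAlg) (𝒰 : Set (Ket QIn →L[ℂ] Ket QIn)) (n : ℕ) : Prop :=
  A.queries ≤ n ∧ ∀ U ∈ 𝒰, ∀ i < A.queries, ∀ (x : Str) (y : Resp) (z : A.Work),
    n < x.length → A.state U i ((x, y), z) = 0

/-- The operations of an algorithm with access to an algorithm `A` and an oracle `U`. The
registers are those of `A` and, besides, query and response registers and a workspace `Z`.
* `loc V`: a unitary on everything except the workspace of `A`;
* `call k`: apply `A.step k` to the registers of `A` (nothing if `A` has no such step);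
* `ask`: apply `U` to one's own query and response registers. -/
inductive RedOp (Z : Type) : Type
  | loc (V : Ket (QIn × (QIn × Z)) ≃ₗᵢ[ℂ] Ket (QIn × (QIn × Z)))
  | call (k : ℕ)
  | ask

/-- The registers of `A`, followed by one's own registers. -/
abbrev RedBasis (A : QAlg) (Z : Type) := (QIn × A.Work) × (QIn × Z)

/-- Singles out everything except the workspace of `A`. -/
def splitWork (A : QAlg) (Z : Type) : RedBasis A Z ≃ A.Work × (QIn × (QIn × Z)) where
  toFun k := (k.1.2, (k.1.1, k.2))
  invFun k := ((k.2.1, k.1), k.2.2)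
  left_inv _ := rfl
  right_inv _ := rfl

/-- Singles out one's own query and response registers. -/
def splitAsk (A : QAlg) (Z : Type) : RedBasis A Z ≃ ((QIn × A.Work) × Z) × QIn where
  toFun k := ((k.1, k.2.2), k.2.1)
  invFun k := (k.1.1, (k.2, k.1.2))
  left_inv _ := rfl
  right_inv _ := rfl

def RedOp.apply {Z : Type} (A : QAlg) (U : Ket QIn →L[ℂ] Ket QIn) :
    RedOp Z → Ket (RedBasis A Z) → Ket (RedBasis A Z)
  | .loc V, ψ => actOn (splitWork A Z) (V : Ket (QIn × (QIn × Z)) →L[ℂ] Ket (QIn × (QIn × Z))) ψ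
  | .call k, ψ =>
      if k ≤ A.queries then
        actOn (Equiv.prodComm (QIn × A.Work) (QIn × Z))
          (A.step k : Ket (QIn × A.Work) →L[ℂ] Ket (QIn × A.Work)) ψ
      else ψ
  | .ask, ψ => actOn (splitAsk A Z) U ψ

/-- Whether the operation is a query (to `A` or to the oracle). -/
def RedOp.isQuery {Z : Type} : RedOp Z → Bool
  | .loc _ => false
  | .call _ => true
  | .ask => true

/-- An algorithm with query access to a query algorithm and to an oracle: it samples `r` from
`coin`, performs the operations `prog r`, measures its workspace and outputs a string. -/
structure Reduction where
  Work : Type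
  work0 : Work
  coin : PMF ℕ
  prog : ℕ → List (RedOp Work)
  out : Work → Str

/-- The state after the operations `l`. -/
def Reduction.exec (B : Reduction) (A : QAlg) (U : Ket QIn →L[ℂ] Ket QIn)
    (l : List (RedOp B.Work)) : Ket (RedBasis A B.Work) :=
  l.foldl (fun ψ o => o.apply A U ψ) (ket ((([], none), A.work0), (([], none), B.work0)))

/-- The probability `Pr[B^{U,A} ∈ T]` that the output lies in `T`. -/
def Reduction.probOut (B : Reduction) (A : QAlg) (U : Ket QIn →L[ℂ] Ket QIn) (T : Set Str) : ℝ :=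
  ∑' r, (B.coin r).toReal * probIn (B.exec A U (B.prog r)) {k | B.out k.2.2 ∈ T}

/-- `B` is an `m`-query algorithm when run with `A` and `U`: at most `m` queries to `A` and `U`
in total, queries to `U` of length at most `m`, and output of length at most `m`. -/
def Reduction.IsQuery (B : Reduction) (A : QAlg) (U : Ket QIn →L[ℂ] Ket QIn) (m : ℕ) : Prop :=
  (∀ r, (B.prog r).countP RedOp.isQuery ≤ m) ∧
  (∀ r l l', B.prog r = l ++ RedOp.ask :: l' →
    ∀ (a : QIn × A.Work) (x : Str) (y : Resp) (z : B.Work), m < x.length →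
      B.exec A U l (a, ((x, y), z)) = 0) ∧
  ∀ z, (B.out z).length ≤ m

/-! ### One-way-to-hiding compatibility -/

/-- For all `q : ℕ → ℕ` there is a `poly(q(λ))`-query algorithm `B` such that for all oracles
`O, O'` of the collection and all `q(λ)`-query algorithms `A` with final states `ψ, ψ'`,
`‖ψ - ψ'‖ ≤ P(q(λ)) · Pr[B^{W_O, A}(1^λ) ∈ T]^c`, where `T = {x : O(x) ≠ O'(x)}`. -/
def OW2HBound (𝕆 : Set Oracle) (W : Oracle → (Ket QIn →L[ℂ] Ket QIn)) (c : ℝ) (P : ℕ → ℝ) : Prop :=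
  ∃ p : Polynomial ℕ, ∀ q : ℕ → ℕ, ∃ B : ℕ → Reduction,
    ∀ A : ℕ → QAlg, (∀ n, (A n).IsQuery (W '' 𝕆) (q n)) →
      ∀ O ∈ 𝕆, ∀ O' ∈ 𝕆, ∀ n,
        (B n).IsQuery (A n) (W O) (p.eval (q n)) ∧
        ‖(A n).final (W O) - (A n).final (W O')‖ ≤
          P (q n) * (B n).probOut (A n) (W O) {x | O x ≠ O' x} ^ c

/-- One-way-to-hiding compatibility with constant `c` of a collection of unitaries `W_O`. -/
structure IsOW2HCompatible (𝕆 : Set Oracle) (W : Oracle → (Ket QIn →L[ℂ] Ket QIn)) (c : ℝ) :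
    Prop where
  isUnitary : ∀ O ∈ 𝕆, W O ∈ unitary (Ket QIn →L[ℂ] Ket QIn)
  /-- `O(x)` is computed exactly, on every input `x`, with a single query to `W_O`. -/
  computes : ∃ (E : Str → QAlg) (out : ∀ x, QIn × (E x).Work → Str),
    (∀ x, (E x).queries = 1) ∧
      ∀ O ∈ 𝕆, ∀ x, probIn ((E x).final (W O)) {k | out x k = O x} = 1
  oneWay : ∃ r : Polynomial ℝ, OW2HBound 𝕆 W c (fun n => r.eval (n : ℝ))

end

/-! ### Block operators -/

/-! Put `v = |D_x⟩ - |⊥⟩`. Then `U_x = I - |v⟩⟨v|`, and `|D_x⟩` is either `|⊥⟩` or a unit vector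
orthogonal to it. So `v = 0` or `‖v‖² = 2`, and `U_x` is the identity or a reflection. This makes
`W^O` an isometric involution, hence unitary (`colUnitary_mem_unitary`).

Evaluation: take a circuit that writes `x`, applies one oracle gate and puts all wires in register
`A`. Its collision distribution is a point mass, and `U` sends `|⊥⟩` to that basis vector, so one
query reveals `O(x)`. The bound on answer lengths fixes a number of response wires that leaves room
for the end marker for every `O` at once (`colUnitary_computes`).

One-wayness combines two hybrid arguments. The outer one bounds the distance of the final states by
the sum over queries of `‖(W^O - W^{O'}) ψ_i‖`, where `ψ_i` is the state of the run with `W^O`. On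
the block of a query string, this difference is controlled by `‖|D_x⟩ - |D'_x⟩‖`, a Hellinger
distance (`norm_sq_swapBot_sub_le`). Doubling the residual state costs only a factor 2 in its
square, relative to the distance of `C^O|0⟩` and `C^{O'}|0⟩` (`sum_sq_doubled_sub_le`,
`norm_sq_distKet_sub_le`). The inner hybrid bounds that distance by the probabilities that the gates
of `C`, run with `O`, query a point of `T` (`norm_runGates_sub_le`).

These probabilities can be sampled with `W^O` alone. Truncating `C` before gate `k` and outputting
all wires gives a circuit whose collision distribution is the measurement of the intermediate state,
and the query of gate `k` can be read off the result. Its description is no longer than that of `C`,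
because wire numbers are unary. The extractor guesses a query `i` and a gate `k`, runs the algorithm
coherently up to query `i`, replaces the query string by the truncated description, queries `W^O`
and outputs the string read off (`tsum_hitStr_le_probIn`).

The outcome is `D² ≤ 64 q² (q+1)² Pr` for the distance `D` of the final states
(`norm_sq_final_sub_le_probOut`). Since `D ≤ 2`, this implies the stated bound with exponent 1/4
(`norm_final_sub_le`). -/

theorem ket_apply {ι : Type} [DecidableEq ι] (i j : ι) : ket i j = if j = i then 1 else 0 := by
  by_cases h : j = i
  · subst h
    simp [ket]
  · simp [ket, h]

theorem blockAt_blockOp {κ β α : Type} (e : κ ≃ β × α) (T : β → Ket α →L[ℂ] Ket α) (M : ℝ)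
    (hM : ∀ b, ‖T b‖ ≤ M) (f : Ket κ) (b : β) :
    blockAt e (blockOp e T M hM f) b = T b (blockAt e f b) := by
  ext a
  rw [blockAt_apply, blockOp_apply, Equiv.apply_symm_apply]

theorem blockOp_blockOp {κ β α : Type} (e : κ ≃ β × α) (T : β → Ket α →L[ℂ] Ket α) (M : ℝ)
    (hM : ∀ b, ‖T b‖ ≤ M) (hT : ∀ b f, T b (T b f) = f) (f : Ket κ) :
    blockOp e T M hM (blockOp e T M hM f) = f := by
  ext k
  rw [blockOp_apply, blockAt_blockOp, hT, blockAt_apply, Prod.mk.eta, Equiv.symm_apply_apply]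

theorem norm_blockOp {κ β α : Type} (e : κ ≃ β × α) (T : β → Ket α →L[ℂ] Ket α) (M : ℝ)
    (hM : ∀ b, ‖T b‖ ≤ M) (hT : ∀ b f, ‖T b f‖ = ‖f‖) (f : Ket κ) :
    ‖blockOp e T M hM f‖ = ‖f‖ := by
  have h := hasSum_blockAt e (blockOp e T M hM f)
  simp only [blockAt_blockOp, hT] at h
  exact (sq_eq_sq₀ (norm_nonneg _) (norm_nonneg _)).1 (h.unique (hasSum_blockAt e f))

theorem norm_actOn {κ β α : Type} (e : κ ≃ β × α) (T : Ket α →L[ℂ] Ket α)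
    (hT : ∀ f, ‖T f‖ = ‖f‖) (f : Ket κ) : ‖actOn e T f‖ = ‖f‖ :=
  norm_blockOp e _ _ _ (fun _ => hT) f

theorem summable_weight {κ : Type} (f : Ket κ) (c : κ → ℝ) (M : ℝ)
    (hc0 : ∀ k, 0 ≤ c k) (hcM : ∀ k, c k ≤ M) : Summable fun k => c k * ‖f k‖ ^ 2 :=
  Summable.of_nonneg_of_le (fun k => mul_nonneg (hc0 k) (sq_nonneg _))
    (fun k => mul_le_mul_of_nonneg_right (hcM k) (sq_nonneg _)) ((ket_summable f).mul_left M)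

/-- Squared norms add up over blocks. The uniform bound `M` serves only to make the weighted series
summable, as `tsum` would otherwise default to 0. -/
theorem norm_sq_le_of_blockAt {κ β α : Type} (e : κ ≃ β × α) (f g : Ket κ) (c : β → ℝ) (M : ℝ)
    (hc0 : ∀ b, 0 ≤ c b) (hcM : ∀ b, c b ≤ M)
    (h : ∀ b, ‖blockAt e g b‖ ^ 2 ≤ c b * ‖blockAt e f b‖ ^ 2) :
    ‖g‖ ^ 2 ≤ ∑' k, c (e k).1 * ‖f k‖ ^ 2 := by
  have hs := summable_weight f (fun k => c (e k).1) M (fun _ => hc0 _) (fun _ => hcM _)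
  have hp : HasSum (fun p : β × α => c p.1 * ‖f (e.symm p)‖ ^ 2)
      (∑' k, c (e k).1 * ‖f k‖ ^ 2) := by
    have := (Equiv.hasSum_iff e.symm (f := fun k => c (e k).1 * ‖f k‖ ^ 2)).2 hs.hasSum
    simpa [Function.comp_def] using this
  have hb : HasSum (fun b => c b * ‖blockAt e f b‖ ^ 2) (∑' k, c (e k).1 * ‖f k‖ ^ 2) := by
    refine hp.prod_fiberwise fun b => ?_
    rw [ket_norm_sq]
    exact ((ket_summable (blockAt e f b)).hasSum).mul_left (c b)
  exact hasSum_le h (hasSum_blockAt e g) hb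

theorem mem_unitary_of_involutive {H : Type*} [NormedAddCommGroup H] [InnerProductSpace ℂ H]
    [CompleteSpace H] (U : H →L[ℂ] H) (hU : ∀ f, U (U f) = f) (hn : ∀ f, ‖U f‖ = ‖f‖) :
    U ∈ unitary (H →L[ℂ] H) := by
  let e : H ≃ₗᵢ[ℂ] H := ⟨LinearEquiv.ofInvolutive (U : H →ₗ[ℂ] H) hU, hn⟩
  have h := (Unitary.linearIsometryEquiv.symm e).2
  rw [Unitary.coe_symm_linearIsometryEquiv_apply] at h
  exact h

/-! ### The swap of `|⊥⟩` and another vector -/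

/-- The form `I - |v⟩⟨v|` with `v = φ - |⊥⟩`, from which all properties of the swap are read off. -/
theorem swapBot_apply (φ f : Ket Resp) :
    swapBot φ f = f - inner ℂ (φ - ket none) f • (φ - ket none) := by
  simp only [swapBot, add_apply, sub_apply,
    one_apply_eq_self, InnerProductSpace.rankOne_apply, inner_sub_left]
  module

theorem norm_sq_sub_bot {φ : Ket Resp} (h : ‖φ‖ = 1) (h0 : inner ℂ (ket none) φ = 0) :
    ‖φ - ket none‖ ^ 2 = 2 := by
  rw [norm_sub_sq (𝕜 := ℂ), h, norm_ket, ← inner_conj_symm, h0]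
  norm_num

/-- Unit vectors that are equal or orthogonal to `|⊥⟩`. -/
def IsBotSplit (φ : Ket Resp) : Prop :=
  φ = ket none ∨ ‖φ‖ = 1 ∧ inner ℂ (ket none) φ = 0

/-- Treats `v = 0` and `‖v‖² = 2` at once: `‖v‖² v = 2 v` is exactly what makes `I - |v⟩⟨v|` an
involution. -/
theorem IsBotSplit.norm_sq_sub_smul {φ : Ket Resp} (h : IsBotSplit φ) :
    ((‖φ - ket none‖ ^ 2 : ℝ) : ℂ) • (φ - ket none) = (2 : ℂ) • (φ - ket none) := by
  rcases h with rfl | ⟨h, h0⟩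
  · simp
  · rw [norm_sq_sub_bot h h0]
    norm_num

theorem IsBotSplit.norm_sq_sub_le {φ : Ket Resp} (h : IsBotSplit φ) :
    ‖φ - ket none‖ ^ 2 ≤ 2 := by
  rcases h with rfl | ⟨h, h0⟩
  · simp
  · rw [norm_sq_sub_bot h h0]

theorem IsBotSplit.swapBot_swapBot {φ : Ket Resp} (h : IsBotSplit φ) (f : Ket Resp) :
    swapBot φ (swapBot φ f) = f := by
  have h1 := congrArg (fun v => inner ℂ (φ - ket none) f • v) h.norm_sq_sub_smul
  simp only [Complex.ofReal_pow] at h1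
  rw [swapBot_apply, swapBot_apply, inner_sub_right, inner_smul_right, inner_self_eq_norm_sq_to_K,
    sub_smul, mul_smul]
  erw [h1]
  module

theorem IsBotSplit.norm_swapBot {φ : Ket Resp} (h : IsBotSplit φ) (f : Ket Resp) :
    ‖swapBot φ f‖ = ‖f‖ := by
  have key : ‖swapBot φ f‖ ^ 2 = ‖f‖ ^ 2 := by
    rw [swapBot_apply, norm_sub_sq (𝕜 := ℂ), inner_smul_right, norm_smul, mul_pow,
      ← inner_conj_symm f, RCLike.mul_conj]
    have h2 : RCLike.re ((‖inner ℂ (φ - ket none) f‖ : ℂ) ^ 2) =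
        ‖inner ℂ (φ - ket none) f‖ ^ 2 := by
      rw [← Complex.ofReal_pow]; exact Complex.ofReal_re _
    erw [h2]
    rcases h with rfl | ⟨h, h0⟩
    · simp
    · rw [norm_sq_sub_bot h h0]
      ring
  exact (sq_eq_sq₀ (norm_nonneg _) (norm_nonneg _)).1 key

theorem IsBotSplit.swapBot_bot {φ : Ket Resp} (h : IsBotSplit φ) :
    swapBot φ (ket none) = φ := by
  rw [swapBot_apply]
  rcases h with rfl | ⟨h, h0⟩
  · simp
  · rw [inner_sub_left, ← inner_conj_symm, h0, inner_self_eq_norm_sq_to_K, norm_ket]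
    simp

/-- With `v = φ - |⊥⟩` and `v' = φ' - |⊥⟩`, `|v⟩⟨v| - |v'⟩⟨v'| = |v⟩⟨φ - φ'| + |φ - φ'⟩⟨v'|`. Both
`v` and `v'` have norm at most `√2`, so the constant is `(2√2)² = 8`. -/
theorem norm_sq_swapBot_sub_le {φ φ' : Ket Resp} (h : IsBotSplit φ) (h' : IsBotSplit φ')
    (f : Ket Resp) :
    ‖swapBot φ f - swapBot φ' f‖ ^ 2 ≤ 8 * ‖φ - φ'‖ ^ 2 * ‖f‖ ^ 2 := by
  have e : swapBot φ f - swapBot φ' f = -(inner ℂ (φ - φ') f • (φ - ket none) +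
      inner ℂ (φ' - ket none) f • (φ - φ')) := by
    rw [swapBot_apply, swapBot_apply]
    simp only [inner_sub_left]
    module
  have b1 := norm_inner_le_norm (𝕜 := ℂ) (φ - φ') f
  have b2 := norm_inner_le_norm (𝕜 := ℂ) (φ' - ket none) f
  have hn : ‖swapBot φ f - swapBot φ' f‖ ≤
      ‖φ - φ'‖ * ‖f‖ * (‖φ - ket none‖ + ‖φ' - ket none‖) := by
    rw [e, norm_neg]
    refine (norm_add_le _ _).trans ?_
    rw [norm_smul, norm_smul]
    have := mul_le_mul_of_nonneg_right b1 (norm_nonneg (φ - ket none))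
    have := mul_le_mul_of_nonneg_right b2 (norm_nonneg (φ - φ'))
    linarith
  have hs : (‖φ - ket none‖ + ‖φ' - ket none‖) ^ 2 ≤ 8 := by
    have := h.norm_sq_sub_le
    have := h'.norm_sq_sub_le
    linarith [add_sq_le (a := ‖φ - ket none‖) (b := ‖φ' - ket none‖)]
  calc _ ≤ (‖φ - φ'‖ * ‖f‖ * (‖φ - ket none‖ + ‖φ' - ket none‖)) ^ 2 :=
        pow_le_pow_left₀ (norm_nonneg _) hn 2
    _ = ‖φ - φ'‖ ^ 2 * ‖f‖ ^ 2 * (‖φ - ket none‖ + ‖φ' - ket none‖) ^ 2 := by ring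
    _ ≤ ‖φ - φ'‖ ^ 2 * ‖f‖ ^ 2 * 8 := mul_le_mul_of_nonneg_left hs (by positivity)
    _ = _ := by ring

/-! ### Permutations of the computational basis -/

/-- The unitary `|i⟩ ↦ |σ i⟩`. -/
noncomputable def permKet {ι : Type} (σ : Equiv.Perm ι) : Ket ι ≃ₗᵢ[ℂ] Ket ι where
  toFun f := ⟨fun i => f (σ.symm i), memlp_two_iff.2
    ((Equiv.summable_iff σ.symm (f := fun i => ‖f i‖ ^ 2)).2 (ket_summable f))⟩
  invFun f := ⟨fun i => f (σ i), memlp_two_iff.2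
    ((Equiv.summable_iff σ (f := fun i => ‖f i‖ ^ 2)).2 (ket_summable f))⟩
  map_add' _ _ := rfl
  map_smul' _ _ := rfl
  left_inv f := by ext i; exact congrArg f (σ.symm_apply_apply i)
  right_inv f := by ext i; exact congrArg f (σ.apply_symm_apply i)
  norm_map' f := by
    refine (sq_eq_sq₀ (norm_nonneg _) (norm_nonneg _)).1 ?_
    rw [ket_norm_sq, ket_norm_sq]
    exact Equiv.tsum_eq σ.symm (fun i => ‖f i‖ ^ 2)

theorem permKet_apply {ι : Type} (σ : Equiv.Perm ι) (f : Ket ι) (i : ι) :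
    permKet σ f i = f (σ.symm i) := rfl

/-! ### The hybrid argument for circuits -/

theorem Gate.apply_sub {n : ℕ} (O : Oracle) (g : Gate n) (ψ ψ' : (Fin n → Bool) → ℂ) :
    g.apply O (ψ - ψ') = g.apply O ψ - g.apply O ψ' := by
  funext b
  cases g <;> simp only [Gate.apply, Pi.sub_apply] <;> ring

/-- The basis states on which the gate makes a query in `T`. -/
def Gate.queryIn {n : ℕ} (T : Set Str) : Gate n → Set (Fin n → Bool)
  | .oracle ins _ _ => {b | ins.map b ∈ T}
  | _ => ∅

/-- Running the gates of a list on the all-zero state. -/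
noncomputable def runGates {n : ℕ} (O : Oracle) (l : List (Gate n)) : (Fin n → Bool) → ℂ :=
  l.foldl (fun ψ g => g.apply O ψ) (Pi.single (fun _ => false) 1)

theorem runGates_concat {n : ℕ} (O : Oracle) (l : List (Gate n)) (g : Gate n) :
    runGates O (l ++ [g]) = g.apply O (runGates O l) := by
  simp [runGates]

theorem sum_norm_sq_runGates {n : ℕ} (O : Oracle) (l : List (Gate n)) :
    ∑ b, ‖runGates O l b‖ ^ 2 = 1 :=
  Circuit.sum_norm_sq_final ⟨n, 0, l⟩ O

/-- The probability that gate number `k` of the list makes a query in `T`. -/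
noncomputable def hitProb {n : ℕ} (O : Oracle) (T : Set Str) (l : List (Gate n)) (k : ℕ) : ℝ :=
  match l[k]? with
  | none => 0
  | some g => ∑ b, (g.queryIn T).indicator (fun b => ‖runGates O (l.take k) b‖ ^ 2) b

theorem hitProb_nonneg {n : ℕ} (O : Oracle) (T : Set Str) (l : List (Gate n)) (k : ℕ) :
    0 ≤ hitProb O T l k := by
  unfold hitProb
  split
  · exact le_rfl
  · exact Finset.sum_nonneg fun b _ => Set.indicator_nonneg (fun _ _ => sq_nonneg _) b

theorem hitProb_le_one {n : ℕ} (O : Oracle) (T : Set Str) (l : List (Gate n)) (k : ℕ) :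
    hitProb O T l k ≤ 1 := by
  unfold hitProb
  split
  · exact zero_le_one
  · rw [← sum_norm_sq_runGates O (l.take k)]
    exact Finset.sum_le_sum fun b _ => Set.indicator_le_self' (fun _ _ => sq_nonneg _) b

theorem hitProb_concat_lt {n : ℕ} (O : Oracle) (T : Set Str) (l : List (Gate n)) (g : Gate n)
    {k : ℕ} (hk : k < l.length) : hitProb O T (l ++ [g]) k = hitProb O T l k := by
  unfold hitProb
  rw [List.getElem?_append_left hk, List.take_append_of_le_length hk.le]

theorem hitProb_concat_length {n : ℕ} (O : Oracle) (T : Set Str) (l : List (Gate n)) (g : Gate n) :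
    hitProb O T (l ++ [g]) l.length =
      ∑ b, (g.queryIn T).indicator (fun b => ‖runGates O l b‖ ^ 2) b := by
  simp [hitProb]

theorem norm_sq_toLp {β : Type} [Fintype β] (ψ : β → ℂ) :
    ‖(WithLp.toLp 2 ψ : EuclideanSpace ℂ β)‖ ^ 2 = ∑ b, ‖ψ b‖ ^ 2 :=
  EuclideanSpace.norm_sq_eq _

theorem Gate.norm_apply {n : ℕ} (O : Oracle) (g : Gate n) (ψ : (Fin n → Bool) → ℂ) :
    ‖(WithLp.toLp 2 (g.apply O ψ) : EuclideanSpace ℂ (Fin n → Bool))‖ =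
      ‖(WithLp.toLp 2 ψ : EuclideanSpace ℂ (Fin n → Bool))‖ := by
  refine (sq_eq_sq₀ (norm_nonneg _) (norm_nonneg _)).1 ?_
  rw [norm_sq_toLp, norm_sq_toLp, Gate.sum_norm_sq_apply]

theorem oracleFlip_ins {n : ℕ} (O : Oracle) (ins outs : List (Fin n))
    (h : (ins ++ outs).Nodup) (b : Fin n → Bool) :
    ins.map (oracleFlip O ins outs b) = ins.map b := by
  refine List.map_congr_left fun w hw => ?_
  have : w ∉ outs := fun h' => (List.disjoint_of_nodup_append h) hw h'
  simp [oracleFlip, this]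

-- Only an oracle gate can see the difference, and only on the part `χ` of `ψ` whose query lies in
-- `T`. Both versions of the gate preserve `‖χ‖`, which gives the factor 2.
open Classical in
theorem Gate.norm_apply_sub_le {n : ℕ} (O O' : Oracle) (g : Gate n) (ψ : (Fin n → Bool) → ℂ) :
    ‖(WithLp.toLp 2 (g.apply O ψ - g.apply O' ψ) : EuclideanSpace ℂ (Fin n → Bool))‖ ≤
      2 * Real.sqrt (∑ b, (g.queryIn {x | O x ≠ O' x}).indicator (fun b => ‖ψ b‖ ^ 2) b) := by
  by_cases hg : ∃ ins outs h, g = Gate.oracle ins outs h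
  · obtain ⟨ins, outs, h, rfl⟩ := hg
    set χ : (Fin n → Bool) → ℂ := fun b => if O (ins.map b) ≠ O' (ins.map b) then ψ b else 0
    have e : (Gate.oracle ins outs h).apply O ψ - (Gate.oracle ins outs h).apply O' ψ =
        (Gate.oracle ins outs h).apply O χ - (Gate.oracle ins outs h).apply O' χ := by
      funext b
      by_cases hb : O (ins.map b) = O' (ins.map b)
      · have hf : oracleFlip O ins outs b = oracleFlip O' ins outs b := by
          unfold oracleFlip
          rw [hb]
        simp [Gate.apply, hf]
      · simp [Gate.apply, χ, oracleFlip_ins _ _ _ h, hb]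
    have hχ : ‖(WithLp.toLp 2 χ : EuclideanSpace ℂ (Fin n → Bool))‖ =
        Real.sqrt (∑ b, ((Gate.oracle ins outs h).queryIn {x | O x ≠ O' x}).indicator
          (fun b => ‖ψ b‖ ^ 2) b) := by
      rw [EuclideanSpace.norm_eq]
      congr 1
      refine Finset.sum_congr rfl fun b _ => ?_
      by_cases hb : O (ins.map b) = O' (ins.map b) <;>
        simp [χ, Gate.queryIn, hb]
    rw [e, WithLp.toLp_sub, ← hχ, two_mul]
    refine (norm_sub_le _ _).trans_eq ?_
    rw [Gate.norm_apply, Gate.norm_apply]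
  · have e : g.apply O ψ = g.apply O' ψ := by
      cases g <;> first | rfl | exact absurd ⟨_, _, _, rfl⟩ hg
    rw [e, sub_self, WithLp.toLp_zero, norm_zero]
    positivity

/-- Telescoping: each new error arises on the state of the run with `O`, and old errors are carried
along isometrically by the gates with `O'`. All weights thus refer to `O`, the only oracle to which
the extractor has access. -/
theorem norm_runGates_sub_le {n : ℕ} (O O' : Oracle) (l : List (Gate n)) :
    ‖(WithLp.toLp 2 (runGates O l - runGates O' l) : EuclideanSpace ℂ (Fin n → Bool))‖ ≤
      ∑ k ∈ Finset.range l.length, 2 * Real.sqrt (hitProb O {x | O x ≠ O' x} l k) := by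
  induction l using List.reverseRecOn with
  | nil => simp [runGates]
  | append_singleton l g ih =>
    have e : runGates O (l ++ [g]) - runGates O' (l ++ [g]) =
        (g.apply O (runGates O l) - g.apply O' (runGates O l)) +
          g.apply O' (runGates O l - runGates O' l) := by
      rw [runGates_concat, runGates_concat, Gate.apply_sub]
      abel
    rw [e, WithLp.toLp_add, List.length_append, List.length_singleton, Finset.sum_range_succ,
      hitProb_concat_length,
      Finset.sum_congr rfl fun k hk => by rw [hitProb_concat_lt _ _ _ _ (Finset.mem_range.1 hk)],
      add_comm]
    refine (norm_add_le _ _).trans (add_le_add ?_ (Gate.norm_apply_sub_le O O' g _))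
    rw [Gate.norm_apply]
    exact ih

theorem sum_norm_sq_runGates_sub_le {n : ℕ} (O O' : Oracle) (l : List (Gate n)) :
    ∑ b, ‖runGates O l b - runGates O' l b‖ ^ 2 ≤
      4 * l.length * ∑ k ∈ Finset.range l.length, hitProb O {x | O x ≠ O' x} l k := by
  have h := pow_le_pow_left₀ (norm_nonneg _) (norm_runGates_sub_le O O' l) 2
  rw [norm_sq_toLp] at h
  refine h.trans ?_
  refine sq_sum_le_card_mul_sum_sq.trans ?_
  simp only [mul_pow, Real.sq_sqrt (hitProb_nonneg O _ l _), ← Finset.mul_sum, Finset.card_range]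
  apply le_of_eq
  ring

/-! ### The Hellinger distance of collision-finding distributions -/

/-- Let `a = ∑ g g' m` be the overlap before doubling; after doubling it is `∑ g g' m²`.
Cauchy–Schwarz and `∑ g g' ≤ 1` give `a² ≤ ∑ g g' m²`. Hence the squared distance after doubling is
at most `2(1 - a²) ≤ 4(1 - a)`, twice the one before. -/
theorem sum_sq_doubled_sub_le {S B : Type} [Fintype S] [Fintype B] (g g' : S → ℝ)
    (r r' : S → B → ℝ) (hg0 : ∀ s, 0 ≤ g s) (hg0' : ∀ s, 0 ≤ g' s)
    (hg : ∑ s, g s ^ 2 = 1) (hg' : ∑ s, g' s ^ 2 = 1)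
    (ha : ∑ p : S × B, (g p.1 * r p.1 p.2) ^ 2 = 1)
    (ha' : ∑ p : S × B, (g' p.1 * r' p.1 p.2) ^ 2 = 1)
    (hd : ∑ t : S × B × B, (g t.1 * (r t.1 t.2.1 * r t.1 t.2.2)) ^ 2 = 1)
    (hd' : ∑ t : S × B × B, (g' t.1 * (r' t.1 t.2.1 * r' t.1 t.2.2)) ^ 2 = 1) :
    ∑ t : S × B × B, (g t.1 * (r t.1 t.2.1 * r t.1 t.2.2) -
        g' t.1 * (r' t.1 t.2.1 * r' t.1 t.2.2)) ^ 2 ≤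
      2 * ∑ p : S × B, (g p.1 * r p.1 p.2 - g' p.1 * r' p.1 p.2) ^ 2 := by
  set m : S → ℝ := fun s => ∑ b, r s b * r' s b with hm
  have e1 : ∑ t : S × B × B, (g t.1 * (r t.1 t.2.1 * r t.1 t.2.2)) *
      (g' t.1 * (r' t.1 t.2.1 * r' t.1 t.2.2)) = ∑ s, g s * g' s * m s ^ 2 := by
    rw [Fintype.sum_prod_type]
    refine Finset.sum_congr rfl fun s _ => ?_
    rw [Fintype.sum_prod_type, sq, hm, Finset.sum_mul_sum, Finset.mul_sum]
    refine Finset.sum_congr rfl fun b _ => ?_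
    rw [Finset.mul_sum]
    exact Finset.sum_congr rfl fun b' _ => by ring
  have e2 : ∑ p : S × B, (g p.1 * r p.1 p.2) * (g' p.1 * r' p.1 p.2) =
      ∑ s, g s * g' s * m s := by
    rw [Fintype.sum_prod_type]
    refine Finset.sum_congr rfl fun s _ => ?_
    rw [hm, Finset.mul_sum]
    exact Finset.sum_congr rfl fun b _ => by ring
  have h1 : ∑ s, g s * g' s ≤ 1 := by
    have : ∑ s, g s * g' s ≤ ∑ s, (g s ^ 2 + g' s ^ 2) / 2 :=
      Finset.sum_le_sum fun s _ => by nlinarith [sq_nonneg (g s - g' s)]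
    rw [← Finset.sum_div, Finset.sum_add_distrib, hg, hg'] at this
    linarith
  have h0 : ∀ s, 0 ≤ g s * g' s := fun s => mul_nonneg (hg0 s) (hg0' s)
  have cs : (∑ s, g s * g' s * m s) ^ 2 ≤ (∑ s, g s * g' s) * ∑ s, g s * g' s * m s ^ 2 :=
    Finset.sum_sq_le_sum_mul_sum_of_sq_le_mul _ (fun s _ => h0 s)
      (fun s _ => mul_nonneg (h0 s) (sq_nonneg _)) (fun s _ => le_of_eq (by ring))
  have hM : 0 ≤ ∑ s, g s * g' s * m s ^ 2 :=
    Finset.sum_nonneg fun s _ => mul_nonneg (h0 s) (sq_nonneg _)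
  simp only [sub_sq, Finset.sum_add_distrib, Finset.sum_sub_distrib, mul_assoc (2 : ℝ),
    ← Finset.mul_sum, ha, ha', hd, hd', e1, e2]
  nlinarith [sq_nonneg (1 - ∑ s, g s * g' s * m s)]

theorem distKet_DCol_apply (O : Oracle) (x : Str) (z : Resp) :
    distKet (DCol O x) z = ((‖colState O x z‖ : ℝ) : ℂ) := by
  change ((Real.sqrt (ENNReal.ofReal (‖colState O x z‖ ^ 2)).toReal : ℝ) : ℂ) = _
  rw [ENNReal.toReal_ofReal (sq_nonneg _), Real.sqrt_sq (norm_nonneg _)]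

theorem sum_smul_ket_apply {ι τ : Type} [Fintype τ] (f : τ → ι) (a : τ → ℂ) (i : ι) :
    (∑ t, a t • ket (f t)) i = ∑ t, a t * ket (f t) i := by
  rw [lp.coeFn_sum, Finset.sum_apply]
  rfl

/-- By injectivity each coordinate receives at most one term, so absolute values can be taken term
by term. -/
theorem norm_sum_smul_ket_apply {ι τ : Type} [Fintype τ] {f : τ → ι} (hf : Function.Injective f)
    (a : τ → ℂ) (i : ι) :
    ((‖(∑ t, a t • ket (f t)) i‖ : ℝ) : ℂ) = (∑ t, ((‖a t‖ : ℝ) : ℂ) • ket (f t)) i := by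
  classical
  rw [sum_smul_ket_apply, sum_smul_ket_apply]
  by_cases h : ∃ t, f t = i
  · obtain ⟨t, rfl⟩ := h
    have h0 : ∀ (c : τ → ℂ), ∑ t', c t' * ket (f t') (f t) = c t := by
      intro c
      rw [Finset.sum_eq_single t]
      · simp [ket_apply]
      · intro t' _ ht
        have : f t ≠ f t' := fun e => ht (hf e).symm
        simp [ket_apply, this]
      · simp
    rw [h0, h0]
  · have h0 : ∀ t, ket (f t) i = 0 := fun t => by
      rw [ket_apply, if_neg fun e => h ⟨t, e.symm⟩]
    simp [h0]

/-- The coefficient of `|s‖b‖b'⟩` in `∑_s √p_s |s⟩|ψ_s⟩|ψ_s⟩`. -/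
noncomputable def Circuit.coeff (C : Circuit) (O : Oracle)
    (t : (Fin C.nA → Bool) × (Fin C.nB → Bool) × (Fin C.nB → Bool)) : ℂ :=
  (Real.sqrt (C.prob O t.1) : ℂ) * (C.residual O t.1 t.2.1 * C.residual O t.1 t.2.2)

theorem Circuit.some_tripleStr_injective (C : Circuit) :
    Function.Injective fun t => (some (C.tripleStr t) : Resp) :=
  (Option.some_injective _).comp C.tripleStr_injective

theorem colState_encode (O : Oracle) (C : Circuit) : colState O C.encode = C.doubled O := by
  unfold colState
  rw [Circuit.decode_encode]

theorem distKet_DCol_encode (O : Oracle) (C : Circuit) :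
    distKet (DCol O C.encode) =
      ∑ t, ((‖C.coeff O t‖ : ℝ) : ℂ) • ket (some (C.tripleStr t) : Resp) := by
  ext z
  rw [distKet_DCol_apply, colState_encode]
  exact norm_sum_smul_ket_apply C.some_tripleStr_injective (C.coeff O) z

theorem Circuit.prob_nonneg (C : Circuit) (O : Oracle) (s : Fin C.nA → Bool) :
    0 ≤ C.prob O s := Finset.sum_nonneg fun _ _ => by positivity

theorem Circuit.norm_amp (C : Circuit) (O : Oracle) (s : Fin C.nA → Bool)
    (b : Fin C.nB → Bool) :
    ‖C.amp O s b‖ = Real.sqrt (C.prob O s) * ‖C.residual O s b‖ := by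
  rw [Circuit.residual, norm_div, Complex.norm_real, Real.norm_of_nonneg (Real.sqrt_nonneg _)]
  -- If `p_s = 0`, all amplitudes over `s` vanish and both sides are 0, whatever the residual is.
  by_cases h : C.prob O s = 0
  · have h1 : ‖C.amp O s b‖ ^ 2 ≤ C.prob O s :=
      Finset.single_le_sum (f := fun b => ‖C.amp O s b‖ ^ 2) (fun _ _ => sq_nonneg _)
        (Finset.mem_univ b)
    rw [h] at h1 ⊢
    have : ‖C.amp O s b‖ = 0 := by nlinarith [norm_nonneg (C.amp O s b)]
    simp [this]
  · have := (Real.sqrt_ne_zero (C.prob_nonneg O s)).2 h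
    field_simp

theorem Circuit.norm_coeff (C : Circuit) (O : Oracle)
    (t : (Fin C.nA → Bool) × (Fin C.nB → Bool) × (Fin C.nB → Bool)) :
    ‖C.coeff O t‖ =
      Real.sqrt (C.prob O t.1) * (‖C.residual O t.1 t.2.1‖ * ‖C.residual O t.1 t.2.2‖) := by
  rw [Circuit.coeff, norm_mul, norm_mul, Complex.norm_real,
    Real.norm_of_nonneg (Real.sqrt_nonneg _)]

theorem Circuit.sum_norm_sq_coeff (C : Circuit) (O : Oracle) : ∑ t, ‖C.coeff O t‖ ^ 2 = 1 := by
  have h := norm_sq_sum_ket C.some_tripleStr_injective (C.coeff O)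
  rw [← h]
  have := C.norm_doubled O
  change ‖C.doubled O‖ ^ 2 = 1
  rw [this, one_pow]

theorem Circuit.sum_amp (C : Circuit) (F : (Fin (C.nA + C.nB) → Bool) → ℝ) :
    ∑ p : (Fin C.nA → Bool) × (Fin C.nB → Bool), F (Fin.append p.1 p.2) = ∑ b, F b :=
  Equiv.sum_comp (Fin.appendEquiv C.nA C.nB) F

/-- `|D_x⟩` carries the absolute values of the amplitudes only. The doubling estimate is therefore
applied to moduli, and the reverse triangle inequality returns to the complex amplitudes. -/
theorem norm_sq_distKet_sub_le (O O' : Oracle) (C : Circuit) :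
    ‖distKet (DCol O C.encode) - distKet (DCol O' C.encode)‖ ^ 2 ≤
      2 * ∑ b, ‖C.final O b - C.final O' b‖ ^ 2 := by
  have hp : ∀ O, ∑ s, Real.sqrt (C.prob O s) ^ 2 = 1 := fun O => by
    simp only [Real.sq_sqrt (C.prob_nonneg O _), C.sum_prob]
  have ha : ∀ O, ∑ p : (Fin C.nA → Bool) × (Fin C.nB → Bool),
      (Real.sqrt (C.prob O p.1) * ‖C.residual O p.1 p.2‖) ^ 2 = 1 := fun O => by
    simp only [← C.norm_amp, Circuit.amp]
    rw [C.sum_amp fun b => ‖C.final O b‖ ^ 2, C.sum_norm_sq_final]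
  have hd : ∀ O, ∑ t : (Fin C.nA → Bool) × (Fin C.nB → Bool) × (Fin C.nB → Bool),
      (Real.sqrt (C.prob O t.1) *
        (‖C.residual O t.1 t.2.1‖ * ‖C.residual O t.1 t.2.2‖)) ^ 2 = 1 := fun O => by
    simp only [← C.norm_coeff, C.sum_norm_sq_coeff]
  have key := sum_sq_doubled_sub_le (fun s => Real.sqrt (C.prob O s))
    (fun s => Real.sqrt (C.prob O' s)) (fun s b => ‖C.residual O s b‖)
    (fun s b => ‖C.residual O' s b‖) (fun _ => Real.sqrt_nonneg _) (fun _ => Real.sqrt_nonneg _)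
    (hp O) (hp O') (ha O) (ha O') (hd O) (hd O')
  rw [distKet_DCol_encode, distKet_DCol_encode, ← Finset.sum_sub_distrib]
  simp only [← sub_smul]
  rw [norm_sq_sum_ket C.some_tripleStr_injective]
  simp only [← Complex.ofReal_sub, Complex.norm_real, Real.norm_eq_abs, sq_abs, C.norm_coeff]
  refine key.trans (mul_le_mul_of_nonneg_left ?_ zero_le_two)
  simp only [← C.norm_amp, Circuit.amp]
  rw [← C.sum_amp fun b => ‖C.final O b - C.final O' b‖ ^ 2]
  refine Finset.sum_le_sum fun p _ => ?_
  rw [← sq_abs]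
  exact pow_le_pow_left₀ (abs_nonneg _) (abs_norm_sub_norm_le _ _) 2

/-! ### The collision-finding unitaries -/

theorem Circuit.encode_of_decode {x : Str} {C : Circuit} (h : Circuit.decode x = some C) :
    C.encode = x := by
  unfold Circuit.decode at h
  split_ifs at h with hx
  rw [← Option.some.inj h]
  exact hx.choose_spec

theorem distKet_DCol_of_decode_eq_none (O : Oracle) {x : Str} (h : Circuit.decode x = none) :
    distKet (DCol O x) = ket none := by
  ext z
  rw [distKet_DCol_apply, colState, h, ket_apply]
  split_ifs <;> simp

theorem distKet_DCol_encode_none (O : Oracle) (C : Circuit) :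
    distKet (DCol O C.encode) none = 0 := by
  rw [distKet_DCol_encode, sum_smul_ket_apply]
  exact Finset.sum_eq_zero fun t _ => by simp [ket_apply]

theorem inner_ket {ι : Type} (i : ι) (f : Ket ι) : inner ℂ (ket i) f = f i := by
  classical
  rw [ket, lp.inner_single_left]
  simp

theorem isBotSplit_distKet (O : Oracle) (x : Str) : IsBotSplit (distKet (DCol O x)) := by
  cases h : Circuit.decode x with
  | none => exact Or.inl (distKet_DCol_of_decode_eq_none O h)
  | some C =>
    refine Or.inr ⟨norm_distKet _, ?_⟩
    rw [inner_ket, ← Circuit.encode_of_decode h, distKet_DCol_encode_none]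

theorem norm_colUnitary (O : Oracle) (f : Ket QIn) : ‖colUnitary O f‖ = ‖f‖ :=
  norm_blockOp (Equiv.refl (Str × Resp)) _ 5 (fun _ => norm_swapBot_le _ (norm_distKet _))
    (fun x f => (isBotSplit_distKet O x).norm_swapBot f) f

theorem colUnitary_mem_unitary (O : Oracle) : colUnitary O ∈ unitary (Ket QIn →L[ℂ] Ket QIn) :=
  mem_unitary_of_involutive _
    (blockOp_blockOp (Equiv.refl (Str × Resp)) _ 5 (fun _ => norm_swapBot_le _ (norm_distKet _))
      fun x f => (isBotSplit_distKet O x).swapBot_swapBot f)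
    (norm_colUnitary O)

/-- Singles out the response register. -/
def splitResp {κ β : Type} (e : κ ≃ β × QIn) : κ ≃ (β × Str) × Resp :=
  e.trans (Equiv.prodAssoc β Str Resp).symm

theorem actOn_colUnitary_apply {κ β : Type} (e : κ ≃ β × QIn) (O : Oracle) (f : Ket κ) (k : κ) :
    actOn e (colUnitary O) f k = swapBot (distKet (DCol O (e k).2.1))
      (blockAt (splitResp e) f ((e k).1, (e k).2.1)) (e k).2.2 := rfl

theorem blockAt_actOn_colUnitary {κ β : Type} (e : κ ≃ β × QIn) (O : Oracle) (f : Ket κ)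
    (b : β × Str) :
    blockAt (splitResp e) (actOn e (colUnitary O) f) b =
      swapBot (distKet (DCol O b.2)) (blockAt (splitResp e) f b) := by
  ext y
  rw [blockAt_apply, actOn_colUnitary_apply]
  simp [splitResp]

/-- Queries keep a bound on the lengths of the query strings. -/
theorem actOn_colUnitary_eq_zero {κ β : Type} (e : κ ≃ β × QIn) (O : Oracle) (f : Ket κ) (m : ℕ)
    (hf : ∀ k, m < (e k).2.1.length → f k = 0) (k : κ) (hk : m < (e k).2.1.length) :
    actOn e (colUnitary O) f k = 0 := by
  have : blockAt (splitResp e) f ((e k).1, (e k).2.1) = 0 := by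
    ext y
    rw [blockAt_apply]
    exact hf _ (by simpa [splitResp] using hk)
  rw [actOn_colUnitary_apply, this, map_zero]
  rfl

/-! ### Lengths of descriptions -/

theorem length_le_length_encList {γ : Type} (enc : γ → Str) (l : List γ) :
    l.length ≤ (encList enc l).length := by
  induction l with
  | nil => simp
  | cons a l ih =>
    simp only [encList, List.length_cons, List.length_append]
    omega

theorem length_encList_take_le {γ : Type} (enc : γ → Str) (l : List γ) (k : ℕ) :
    (encList enc (l.take k)).length ≤ (encList enc l).length := by
  induction l generalizing k with
  | nil => simp
  | cons a l ih =>
    cases k with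
    | zero => simp [encList]
    | succ k =>
      have := ih k
      simp only [List.take_succ_cons, encList, List.length_cons, List.length_append]
      omega

theorem Circuit.length_encode (C : Circuit) :
    C.encode.length = C.nA + 1 + (C.nB + 1 + (encList Gate.encode C.gates).length) := by
  simp only [Circuit.encode, encNat, List.length_append, List.length_replicate,
    List.length_singleton]

/-- The circuit that applies the first `k` gates of `C` and outputs all wires. -/
def Circuit.prefixAll (C : Circuit) (k : ℕ) : Circuit := ⟨C.nA + C.nB, 0, C.gates.take k⟩

/-- In unary, the sizes `nA + nB` and `0` take as much space as `nA` and `nB`, and dropping gates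
only shortens the list. -/
theorem Circuit.length_encode_prefixAll_le (C : Circuit) (k : ℕ) :
    (C.prefixAll k).encode.length ≤ C.encode.length := by
  have := length_encList_take_le Gate.encode C.gates k
  simp only [Circuit.length_encode, Circuit.prefixAll]
  omega

/-- The probability that gate number `k` of the circuit described by `x` makes a query in `T`. -/
noncomputable def hitStr (O : Oracle) (T : Set Str) (x : Str) (k : ℕ) : ℝ :=
  match Circuit.decode x with
  | none => 0
  | some C => hitProb O T C.gates k

theorem hitStr_nonneg (O : Oracle) (T : Set Str) (x : Str) (k : ℕ) : 0 ≤ hitStr O T x k := by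
  unfold hitStr
  split
  · exact le_rfl
  · exact hitProb_nonneg _ _ _ _

theorem hitStr_le_one (O : Oracle) (T : Set Str) (x : Str) (k : ℕ) : hitStr O T x k ≤ 1 := by
  unfold hitStr
  split
  · exact zero_le_one
  · exact hitProb_le_one _ _ _ _

/-- The constant is 2 from doubling times 4 from the hybrid over gates; the factor `q` bounds the
number of gates by the length of the description. -/
theorem norm_sq_distKet_sub_le_hitStr (O O' : Oracle) (x : Str) (q : ℕ) (hx : x.length ≤ q) :
    ‖distKet (DCol O x) - distKet (DCol O' x)‖ ^ 2 ≤
      8 * q * ∑ k ∈ Finset.range q, hitStr O {x | O x ≠ O' x} x k := by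
  cases h : Circuit.decode x with
  | none =>
    simp [distKet_DCol_of_decode_eq_none _ h, hitStr, h]
  | some C =>
    have hl : C.gates.length ≤ q := by
      have h1 := length_le_length_encList Gate.encode C.gates
      have h2 := C.length_encode
      rw [Circuit.encode_of_decode h] at h2
      omega
    have h1 := norm_sq_distKet_sub_le O O' C
    rw [Circuit.encode_of_decode h] at h1
    refine h1.trans ?_
    have h2 := sum_norm_sq_runGates_sub_le O O' C.gates
    have h3 : ∑ k ∈ Finset.range C.gates.length, hitProb O {x | O x ≠ O' x} C.gates k ≤
        ∑ k ∈ Finset.range q, hitProb O {x | O x ≠ O' x} C.gates k :=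
      Finset.sum_le_sum_of_subset_of_nonneg (Finset.range_subset_range.2 hl)
        fun _ _ _ => hitProb_nonneg _ _ _ _
    have h4 : (C.gates.length : ℝ) ≤ q := by exact_mod_cast hl
    have h5 := mul_le_mul h4 h3 (Finset.sum_nonneg fun _ _ => hitProb_nonneg _ _ _ _)
      (Nat.cast_nonneg q)
    simp only [hitStr, h]
    change 2 * ∑ b, ‖runGates O C.gates b - runGates O' C.gates b‖ ^ 2 ≤ _
    linarith

/-! ### The hybrid argument for query algorithms -/

/-- The response blocks give `8 ‖|D_x⟩ - |D'_x⟩‖²`, and the distance of the distributions another `8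
q`; strings longer than `q` carry no amplitude. -/
theorem norm_sq_query_sub_le {κ β : Type} (e : κ ≃ β × QIn) (O O' : Oracle) (f : Ket κ) (q : ℕ)
    (hf : ∀ k, q < (e k).2.1.length → f k = 0) :
    ‖actOn e (colUnitary O) f - actOn e (colUnitary O') f‖ ^ 2 ≤
      64 * q * ∑ j ∈ Finset.range q,
        ∑' k, hitStr O {x | O x ≠ O' x} (e k).2.1 j * ‖f k‖ ^ 2 := by
  set d : Str → ℝ := fun x => 8 * ‖distKet (DCol O x) - distKet (DCol O' x)‖ ^ 2
  have hd0 : ∀ x, 0 ≤ d x := fun x => by positivity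
  have hdM : ∀ x, d x ≤ 32 := fun x => by
    have h1 := norm_sub_le (distKet (DCol O x)) (distKet (DCol O' x))
    rw [norm_distKet, norm_distKet] at h1
    have h2 := pow_le_pow_left₀ (norm_nonneg _) h1 2
    simp only [d]
    linarith
  have h1 : ‖actOn e (colUnitary O) f - actOn e (colUnitary O') f‖ ^ 2 ≤
      ∑' k, d (e k).2.1 * ‖f k‖ ^ 2 := by
    refine norm_sq_le_of_blockAt (splitResp e) f _ (fun b => d b.2) 32 (fun _ => hd0 _)
      (fun _ => hdM _) fun b => ?_
    have : blockAt (splitResp e) (actOn e (colUnitary O) f - actOn e (colUnitary O') f) b =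
        swapBot (distKet (DCol O b.2)) (blockAt (splitResp e) f b) -
          swapBot (distKet (DCol O' b.2)) (blockAt (splitResp e) f b) := by
      rw [← blockAt_actOn_colUnitary, ← blockAt_actOn_colUnitary]
      rfl
    rw [this]
    exact norm_sq_swapBot_sub_le (isBotSplit_distKet O _) (isBotSplit_distKet O' _) _
  have hs : ∀ j, Summable fun k => hitStr O {x | O x ≠ O' x} (e k).2.1 j * ‖f k‖ ^ 2 := fun j =>
    summable_weight f _ 1 (fun _ => hitStr_nonneg _ _ _ _) (fun _ => hitStr_le_one _ _ _ _)
  refine h1.trans ?_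
  rw [← Summable.tsum_finsetSum fun j _ => hs j, ← tsum_mul_left]
  refine (summable_weight f (fun k => d (e k).2.1) 32 (fun _ => hd0 _)
    (fun _ => hdM _)).tsum_le_tsum (fun k => ?_) ((summable_sum fun j _ => hs j).mul_left _)
  by_cases hk : q < (e k).2.1.length
  · simp [hf k hk]
  · have := norm_sq_distKet_sub_le_hitStr O O' (e k).2.1 q (not_lt.1 hk)
    rw [← Finset.sum_mul, ← mul_assoc]
    refine mul_le_mul_of_nonneg_right ?_ (sq_nonneg _)
    simp only [d]
    linarith

theorem QAlg.norm_state (A : QAlg) (O : Oracle) (i : ℕ) : ‖A.state (colUnitary O) i‖ = 1 := by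
  induction i with
  | zero => rw [QAlg.state, LinearIsometryEquiv.norm_map, norm_ket]
  | succ i ih =>
    rw [QAlg.state, LinearIsometryEquiv.norm_map, norm_actOn _ _ (norm_colUnitary O), ih]

/-- The same telescoping as for circuits, again with every error measured on the run with `O`. -/
theorem QAlg.norm_state_sub_le (A : QAlg) (O O' : Oracle) (i : ℕ) :
    ‖A.state (colUnitary O) i - A.state (colUnitary O') i‖ ≤ ∑ j ∈ Finset.range i,
      ‖actOn (Equiv.prodComm QIn A.Work) (colUnitary O) (A.state (colUnitary O) j) -
        actOn (Equiv.prodComm QIn A.Work) (colUnitary O') (A.state (colUnitary O) j)‖ := by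
  induction i with
  | zero => simp [QAlg.state]
  | succ i ih =>
    rw [QAlg.state, QAlg.state, ← map_sub, LinearIsometryEquiv.norm_map, Finset.sum_range_succ,
      add_comm]
    refine (norm_sub_le_norm_sub_add_norm_sub _ (actOn (Equiv.prodComm QIn A.Work)
      (colUnitary O') (A.state (colUnitary O) i)) _).trans (add_le_add le_rfl ?_)
    rw [← map_sub, norm_actOn _ _ (norm_colUnitary O')]
    exact ih

theorem QAlg.norm_sq_final_sub_le (A : QAlg) (O O' : Oracle) (q : ℕ) (hq : A.queries ≤ q)
    (hA : ∀ i < A.queries, ∀ (x : Str) (y : Resp) (z : A.Work),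
      q < x.length → A.state (colUnitary O) i ((x, y), z) = 0) :
    ‖A.final (colUnitary O) - A.final (colUnitary O')‖ ^ 2 ≤
      64 * q ^ 2 * ∑ i ∈ Finset.range A.queries, ∑ j ∈ Finset.range q,
        ∑' k, hitStr O {x | O x ≠ O' x} k.1.1 j * ‖A.state (colUnitary O) i k‖ ^ 2 := by
  have h1 := pow_le_pow_left₀ (norm_nonneg _) (A.norm_state_sub_le O O' A.queries) 2
  refine h1.trans (sq_sum_le_card_mul_sum_sq.trans ?_)
  rw [Finset.card_range]
  have h2 := Finset.sum_le_sum fun i (hi : i ∈ Finset.range A.queries) =>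
    norm_sq_query_sub_le (Equiv.prodComm QIn A.Work) O O' (A.state (colUnitary O) i) q
      fun k hk => hA i (Finset.mem_range.1 hi) k.1.1 k.1.2 k.2 hk
  have h3 : (A.queries : ℝ) ≤ q := by exact_mod_cast hq
  refine (mul_le_mul h3 h2 (Finset.sum_nonneg fun _ _ => sq_nonneg _)
    (Nat.cast_nonneg q)).trans (le_of_eq ?_)
  rw [← Finset.mul_sum]
  simp only [Equiv.prodComm_apply, Prod.snd_swap]
  ring

/-! ### Circuits that measure all their wires -/

/-- The circuit on `n` output wires with the gates `l`. -/
def flatCircuit {n : ℕ} (l : List (Gate n)) : Circuit := ⟨n, 0, l⟩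

theorem flatCircuit_norm_coeff {n : ℕ} (l : List (Gate n)) (O : Oracle)
    (t : (Fin (flatCircuit l).nA → Bool) × (Fin (flatCircuit l).nB → Bool) ×
      (Fin (flatCircuit l).nB → Bool)) :
    ‖(flatCircuit l).coeff O t‖ = ‖runGates O l t.1‖ := by
  obtain ⟨s, b, b'⟩ := t
  have : Subsingleton (Fin (flatCircuit l).nB → Bool) :=
    inferInstanceAs (Subsingleton (Fin 0 → Bool))
  obtain rfl : b = b' := Subsingleton.elim _ _
  have hp : (flatCircuit l).prob O s = ‖(flatCircuit l).amp O s b‖ ^ 2 :=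
    Fintype.sum_subsingleton _ b
  have ha := (flatCircuit l).norm_amp O s b
  rw [hp, Real.sqrt_sq (norm_nonneg _)] at ha
  have hc := (flatCircuit l).norm_coeff O (s, b, b)
  -- Here `√p_s = |amp|`, and `ha` says `|amp| = |amp| · |residual|`. It absorbs both residual
  -- factors, with no case distinction on `p_s = 0`.
  rw [hp, Real.sqrt_sq (norm_nonneg _), ← mul_assoc, ← ha, ← ha] at hc
  rw [hc]
  change ‖runGates O l (Fin.append s b)‖ = _
  congr 2
  funext i
  exact Fin.append_left s b i

theorem distKet_DCol_flatCircuit {n : ℕ} (l : List (Gate n)) (O : Oracle) :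
    distKet (DCol O (flatCircuit l).encode) =
      ∑ s : Fin n → Bool, ((‖runGates O l s‖ : ℝ) : ℂ) • ket (some (List.ofFn s) : Resp) := by
  have : Subsingleton (Fin (flatCircuit l).nB → Bool) :=
    inferInstanceAs (Subsingleton (Fin 0 → Bool))
  have b₀ : Fin (flatCircuit l).nB → Bool := fun _ => false
  rw [distKet_DCol_encode, Fintype.sum_prod_type]
  refine Finset.sum_congr rfl fun s _ => ?_
  rw [Fintype.sum_subsingleton _ (b₀, b₀), flatCircuit_norm_coeff]
  have h : List.ofFn b₀ = [] := List.ofFn_zero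
  simp only [Circuit.tripleStr, h, List.append_nil]
  rfl

theorem distKet_DCol_flatCircuit_apply {n : ℕ} (l : List (Gate n)) (O : Oracle)
    (s : Fin n → Bool) :
    distKet (DCol O (flatCircuit l).encode) (some (List.ofFn s)) = (‖runGates O l s‖ : ℝ) := by
  rw [distKet_DCol_flatCircuit, sum_smul_ket_apply, Finset.sum_eq_single s]
  · simp [ket_apply]
  · intro t _ ht
    have : List.ofFn s ≠ List.ofFn t := fun h => ht (List.ofFn_injective h).symm
    simp [ket_apply, this]
  · simp

theorem exists_of_distKet_DCol_flatCircuit_ne_zero {n : ℕ} (l : List (Gate n)) (O : Oracle)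
    (z : Resp) (hz : distKet (DCol O (flatCircuit l).encode) z ≠ 0) :
    ∃ s : Fin n → Bool, z = some (List.ofFn s) ∧ runGates O l s ≠ 0 := by
  rw [distKet_DCol_flatCircuit, sum_smul_ket_apply] at hz
  obtain ⟨s, _, hs⟩ := Finset.exists_ne_zero_of_sum_ne_zero hz
  have h1 := left_ne_zero_of_mul hs
  have h2 := right_ne_zero_of_mul hs
  refine ⟨s, ?_, by simpa using h1⟩
  rw [ket_apply] at h2
  by_contra h
  exact h2 (if_neg h)

/-! ### Evaluating the oracle with one query -/

theorem Gate.not_apply_single {n : ℕ} (O : Oracle) (t : Fin n) (b : Fin n → Bool) :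
    (Gate.not t).apply O (Pi.single b 1) = Pi.single (Function.update b t (!b t)) 1 := by
  funext b'
  have h : Function.update b' t (!b' t) = b ↔ b' = Function.update b t (!b t) := by
    constructor <;> rintro rfl <;> simp
  simp only [Gate.apply, Pi.single_apply, h]

theorem runGates_map_not {n : ℕ} (O : Oracle) (l : List (Fin n)) (hl : l.Nodup) :
    runGates O (l.map Gate.not) = Pi.single (fun w => decide (w ∈ l)) 1 := by
  induction l using List.reverseRecOn with
  | nil => simp [runGates]
  | append_singleton l t ih =>
    have h := List.nodup_append.1 hl
    have ht : t ∉ l := fun h' => h.2.2 t h' t (by simp) rfl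
    rw [List.map_append, List.map_singleton, runGates_concat, ih h.1, Gate.not_apply_single]
    congr 1
    funext w
    by_cases hw : w = t
    · subst hw
      simp [ht]
    · simp [hw]

/-- The wires that carry the query of the evaluation circuit. -/
def evalIns (n m : ℕ) : List (Fin (n + m)) := List.ofFn (Fin.castAdd m)

/-- The wires that carry the response of the evaluation circuit. -/
def evalOuts (n m : ℕ) : List (Fin (n + m)) := List.ofFn (Fin.natAdd n)

theorem nodup_evalIns_evalOuts (n m : ℕ) : (evalIns n m ++ evalOuts n m).Nodup := by
  rw [evalIns, evalOuts, List.nodup_append]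
  refine ⟨List.nodup_ofFn.2 (Fin.castAdd_injective n m),
    List.nodup_ofFn.2 (Fin.natAdd_injective m n), ?_⟩
  intro a ha b hb hab
  rw [List.mem_ofFn] at ha hb
  obtain ⟨i, rfl⟩ := ha
  obtain ⟨j, rfl⟩ := hb
  have := congrArg Fin.val hab
  have hi := i.2
  simp only [Fin.val_castAdd, Fin.val_natAdd] at this
  omega

/-- The basis state `|x⟩|0⟩`. -/
def evalInput (x : Str) (m : ℕ) : Fin (x.length + m) → Bool :=
  Fin.append x.get fun _ => false

/-- The gates that write `x` and apply the oracle with `m` response wires. -/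
def evalGates (x : Str) (m : ℕ) : List (Gate (x.length + m)) :=
  ((List.finRange (x.length + m)).filter (evalInput x m)).map Gate.not ++
    [Gate.oracle (evalIns x.length m) (evalOuts x.length m) (nodup_evalIns_evalOuts _ _)]

theorem runGates_evalGates (O : Oracle) (x : Str) (m : ℕ) (b : Fin (x.length + m) → Bool)
    (hb : runGates O (evalGates x m) b ≠ 0) :
    b = oracleFlip O (evalIns x.length m) (evalOuts x.length m) (evalInput x m) := by
  rw [evalGates, runGates_concat, runGates_map_not _ _ ((List.nodup_finRange _).filter _)] at hb
  have e : (fun w => decide (w ∈ (List.finRange (x.length + m)).filter (evalInput x m))) =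
      evalInput x m := by
    funext w
    simp [List.mem_filter]
  rw [e] at hb
  have h : oracleFlip O (evalIns x.length m) (evalOuts x.length m) b = evalInput x m := by
    by_contra h
    exact hb (by simp [Gate.apply, h])
  rw [← h, oracleFlip_involutive O _ _ (nodup_evalIns_evalOuts _ _)]

theorem map_evalIns (x : Str) (m : ℕ) : (evalIns x.length m).map (evalInput x m) = x := by
  have h : (fun i => evalInput x m (Fin.castAdd m i)) = x.get := by
    funext i
    exact Fin.append_left _ _ i
  rw [evalIns, List.map_ofFn]
  change List.ofFn (fun i => evalInput x m (Fin.castAdd m i)) = x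
  rw [h, List.ofFn_get]

theorem ofFn_oracleFlip_evalInput (O : Oracle) (x : Str) (m : ℕ) :
    List.ofFn (oracleFlip O (evalIns x.length m) (evalOuts x.length m) (evalInput x m)) =
      x ++ List.ofFn fun j : Fin m => answerBit (O x) j := by
  have h : oracleFlip O (evalIns x.length m) (evalOuts x.length m) (evalInput x m) =
      Fin.append x.get fun j : Fin m => answerBit (O x) j := by
    funext w
    rw [oracleFlip, map_evalIns]
    refine Fin.addCases (fun i => ?_) (fun j => ?_) w
    · have hi : Fin.castAdd m i ∉ evalOuts x.length m := by
        intro h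
        rw [evalOuts, List.mem_ofFn] at h
        obtain ⟨j, hj⟩ := h
        have := congrArg Fin.val hj
        have hi := i.2
        simp only [Fin.val_castAdd, Fin.val_natAdd] at this
        omega
      rw [if_neg hi, Fin.append_left, evalInput, Fin.append_left]
    · have hj : Fin.natAdd x.length j ∈ evalOuts x.length m := List.mem_ofFn.2 ⟨j, rfl⟩
      have hidx : (evalOuts x.length m).idxOf (Fin.natAdd x.length j) = j := by
        have hlen : (j : ℕ) < (evalOuts x.length m).length := by
          simp [evalOuts]
        have hget : (evalOuts x.length m)[(j : ℕ)] = Fin.natAdd x.length j := by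
          simp [evalOuts]
        rw [← hget]
        exact List.Nodup.idxOf_getElem (List.nodup_ofFn.2 (Fin.natAdd_injective m x.length)) _ _
      rw [if_pos hj, hidx, Fin.append_right, evalInput, Fin.append_right, Bool.false_xor]
  rw [h, List.ofFn_fin_append, List.ofFn_get]

/-- Removes the end marker and the zeros after it. -/
def unpad (y : Str) : Str := ((y.reverse.dropWhile fun b => !b).drop 1).reverse

theorem ofFn_answerBit (y : Str) (m : ℕ) (h : y.length < m) :
    (List.ofFn fun j : Fin m => answerBit y j) =
      y ++ [true] ++ List.replicate (m - (y.length + 1)) false := by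
  refine List.ext_getElem ?_ fun i h1 h2 => ?_
  · simp
    omega
  · simp only [List.getElem_ofFn, answerBit]
    by_cases hi : i < (y ++ [true]).length
    · rw [List.getElem_append_left hi, List.getD_eq_getElem _ _ hi]
    · rw [List.getElem_append_right (not_lt.1 hi), List.getD_eq_default _ _ (not_lt.1 hi)]
      simp

theorem unpad_ofFn_answerBit (y : Str) (m : ℕ) (h : y.length < m) :
    unpad (List.ofFn fun j : Fin m => answerBit y j) = y := by
  rw [ofFn_answerBit y m h, unpad]
  have h0 : ∀ n : ℕ, (List.replicate n false ++ true :: y.reverse).dropWhile (fun b => !b) =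
      true :: y.reverse := by
    intro n
    induction n with
    | zero => simp
    | succ n ih => simp [List.replicate_succ, ih]
  simp [h0]

theorem permKet_swap_ket {ι : Type} [DecidableEq ι] (i j : ι) :
    permKet (Equiv.swap i j) (ket i) = ket j := by
  ext k
  simp only [permKet_apply, ket_apply, Equiv.symm_swap, Equiv.swap_apply_eq_iff,
    Equiv.swap_apply_left]

/-- Query the string `x` on the response `|⊥⟩`. -/
noncomputable def evalAlg (x : Str) : QAlg where
  Work := Unit
  work0 := ()
  queries := 1
  step i := if i = 0 then permKet (Equiv.swap (([], none), ()) ((x, none), ()))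
    else LinearIsometryEquiv.refl ℂ _

theorem evalAlg_final_apply (O : Oracle) (x x' : Str) (y : Resp) (w : Unit) :
    (evalAlg x).final (colUnitary O) ((x', y), w) =
      if x' = x then distKet (DCol O x) y else 0 := by
  have h0 : (evalAlg x).state (colUnitary O) 0 = (ket ((x, none), ()) : Ket (QIn × Unit)) :=
    permKet_swap_ket _ _
  change actOn (Equiv.prodComm QIn Unit) (colUnitary O)
    ((evalAlg x).state (colUnitary O) 0) ((x', y), w) = _
  rw [h0, actOn_colUnitary_apply]
  simp only [Equiv.prodComm_apply, Prod.swap_prod_mk]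
  split_ifs with h
  · subst h
    have : blockAt (splitResp (Equiv.prodComm QIn Unit)) (ket ((x', none), ())) (w, x') =
        ket none := by
      ext z
      simp [blockAt_apply, splitResp, ket_apply]
    rw [this, (isBotSplit_distKet O x').swapBot_bot]
  · have : blockAt (splitResp (Equiv.prodComm QIn Unit)) (ket ((x, none), ())) (w, x') = 0 := by
      ext z
      simp [blockAt_apply, splitResp, ket_apply, h]
    rw [this, map_zero]
    rfl

theorem probIn_eq_norm_sq {κ : Type} (ψ : Ket κ) (S : Set κ) (h : ∀ k, ψ k ≠ 0 → k ∈ S) :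
    probIn ψ S = ‖ψ‖ ^ 2 := by
  rw [probIn, ket_norm_sq]
  refine tsum_congr fun k => ?_
  by_cases hk : k ∈ S
  · rw [Set.indicator_of_mem hk]
  · rw [Set.indicator_of_notMem hk]
    have : ψ k = 0 := by
      by_contra h'
      exact hk (h k h')
    simp [this]

theorem colUnitary_computes (𝕆 : Set Oracle)
    (h𝕆 : ∀ x : Str, ∃ m : ℕ, ∀ O ∈ 𝕆, (O x).length ≤ m) :
    ∃ (E : Str → QAlg) (out : ∀ x, QIn × (E x).Work → Str),
      (∀ x, (E x).queries = 1) ∧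
        ∀ O ∈ 𝕆, ∀ x, probIn ((E x).final (colUnitary O)) {k | out x k = O x} = 1 := by
  choose m hm using h𝕆
  -- One wire more than the longest answer, so that the end marker always fits and `unpad` recovers
  -- `O x`.
  refine ⟨fun x => evalAlg (flatCircuit (evalGates x (m x + 1))).encode,
    fun x k => unpad ((k.1.2.getD []).drop x.length), fun _ => rfl, fun O hO x => ?_⟩
  rw [probIn_eq_norm_sq]
  · rw [QAlg.final, QAlg.norm_state, one_pow]
  · rintro ⟨⟨x', y⟩, w⟩ hk
    replace hk := (evalAlg_final_apply O _ x' y w).symm.trans_ne hk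
    split_ifs at hk with hx
    · obtain ⟨b, rfl, hb⟩ := exists_of_distKet_DCol_flatCircuit_ne_zero _ O y hk
      rw [runGates_evalGates O x _ b hb]
      simp only [Set.mem_ofPred_eq, Option.getD_some, ofFn_oracleFlip_evalInput, List.drop_left]
      exact unpad_ofFn_answerBit _ _ (Nat.lt_succ_of_le (hm x O hO))
    · exact absurd rfl hk

/-! ### The operations of the extractor -/

/-- The classical reversible map that swaps the query and response registers of the algorithm
with one's own, if both query strings have length at most `m`. -/
def boundedSwap (m : ℕ) : Equiv.Perm (QIn × (QIn × Str)) :=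
  Function.Involutive.toPerm
    (fun k => if k.1.1.length ≤ m ∧ k.2.1.1.length ≤ m then (k.2.1, (k.1, k.2.2)) else k) <| by
    rintro ⟨a, b, z⟩
    by_cases h : a.1.length ≤ m ∧ b.1.length ≤ m
    · simp [h]
    · simp [h]

/-- The classical reversible map that writes `g x` into one's own empty query register, where
`x` is the query of the algorithm. -/
def writeQuery (g : Str → Str) : Equiv.Perm (QIn × (QIn × Str)) :=
  Function.Involutive.toPerm
    (fun k => (k.1, ((Equiv.swap [] (g k.1.1) k.2.1.1, k.2.1.2), k.2.2))) fun k => by simp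

/-- The classical reversible map that writes `F x y` into one's own empty workspace, where `x` is
the query of the algorithm and `y` the content of one's own response register. -/
def writeOut (F : Str → Resp → Str) : Equiv.Perm (QIn × (QIn × Str)) :=
  Function.Involutive.toPerm
    (fun k => (k.1, (k.2.1, Equiv.swap [] (F k.1.1 k.2.1.2) k.2.2))) fun k => by simp

theorem boundedSwap_symm_apply_of_le {m : ℕ} {a b : QIn} (z : Str)
    (h : a.1.length ≤ m ∧ b.1.length ≤ m) :
    (boundedSwap m).symm (a, (b, z)) = (b, (a, z)) := if_pos h

theorem boundedSwap_symm_apply_of_not_le {m : ℕ} {a b : QIn} (z : Str)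
    (h : ¬(a.1.length ≤ m ∧ b.1.length ≤ m)) :
    (boundedSwap m).symm (a, (b, z)) = (a, (b, z)) := if_neg h

theorem writeQuery_symm_apply (g : Str → Str) (a : QIn) (x : Str) (y : Resp) (z : Str) :
    (writeQuery g).symm (a, ((x, y), z)) = (a, ((Equiv.swap [] (g a.1) x, y), z)) := rfl

theorem apply_loc_permKet (A : QAlg) (U : Ket QIn →L[ℂ] Ket QIn)
    (σ : Equiv.Perm (QIn × (QIn × Str))) (ψ : Ket (RedBasis A Str)) (a : QIn) (w : A.Work)
    (c : QIn × Str) :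
    (RedOp.loc (permKet σ)).apply A U ψ ((a, w), c) =
      ψ (((σ.symm (a, c)).1, w), (σ.symm (a, c)).2) := rfl

/-- The state `f` of the algorithm, with one's own registers in the initial state. -/
def IsIdle {A : QAlg} (ψ : Ket (RedBasis A Str)) (f : Ket (QIn × A.Work)) : Prop :=
  ∀ a c, ψ (a, c) = if c = (([], none), []) then f a else 0

/-- The state `f` of the algorithm, with its query and response registers swapped with one's own
registers, which were in the initial state. -/
def IsSwapped {A : QAlg} (ψ : Ket (RedBasis A Str)) (f : Ket (QIn × A.Work)) : Prop :=
  ∀ a w b z, ψ ((a, w), (b, z)) = if a = ([], none) ∧ z = [] then f (b, w) else 0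

/-- The query strings have length at most `m`. -/
def ShortQuery {A : QAlg} (m : ℕ) (f : Ket (QIn × A.Work)) : Prop :=
  ∀ a w, m < a.1.length → f (a, w) = 0

/-- The swap refuses to act only on long query strings, where `f` vanishes; here it agrees with an
unconditional swap. -/
theorem IsIdle.boundedSwap {A : QAlg} {ψ : Ket (RedBasis A Str)} {f : Ket (QIn × A.Work)}
    (h : IsIdle ψ f) (m : ℕ) (hf : ShortQuery m f) (U : Ket QIn →L[ℂ] Ket QIn) :
    IsSwapped ((RedOp.loc (permKet (boundedSwap m))).apply A U ψ) f := by
  intro a w b z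
  rw [apply_loc_permKet]
  by_cases h1 : a.1.length ≤ m ∧ b.1.length ≤ m
  · rw [boundedSwap_symm_apply_of_le z h1, h]
    simp only [Prod.mk.injEq]
  · rw [boundedSwap_symm_apply_of_not_le z h1, h]
    split_ifs with h2 h3 h3
    · obtain ⟨rfl, rfl⟩ := h3
      obtain ⟨rfl, -⟩ := Prod.ext_iff.1 h2
      rfl
    · obtain ⟨rfl, -⟩ := Prod.ext_iff.1 h2
      exact hf _ _ (by simpa using h1)
    · obtain ⟨rfl, -⟩ := h3
      exact (hf _ _ (by simpa using h1)).symm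
    · rfl

theorem IsSwapped.boundedSwap {A : QAlg} {ψ : Ket (RedBasis A Str)} {f : Ket (QIn × A.Work)}
    (h : IsSwapped ψ f) (m : ℕ) (hf : ShortQuery m f) (U : Ket QIn →L[ℂ] Ket QIn) :
    IsIdle ((RedOp.loc (permKet (boundedSwap m))).apply A U ψ) f := by
  rintro ⟨a, w⟩ ⟨b, z⟩
  rw [apply_loc_permKet]
  by_cases h1 : a.1.length ≤ m ∧ b.1.length ≤ m
  · rw [boundedSwap_symm_apply_of_le z h1, h]
    simp only [Prod.mk.injEq]
  · rw [boundedSwap_symm_apply_of_not_le z h1, h]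
    split_ifs with h2 h3 h3
    · obtain ⟨rfl, -⟩ := Prod.ext_iff.1 h3
      obtain ⟨rfl, -⟩ := h2
      rfl
    · obtain ⟨rfl, -⟩ := h2
      exact hf _ _ (by simpa using h1)
    · obtain ⟨rfl, -⟩ := Prod.ext_iff.1 h3
      exact (hf _ _ (by simpa using h1)).symm
    · rfl

theorem IsSwapped.ask {A : QAlg} {ψ : Ket (RedBasis A Str)} {f : Ket (QIn × A.Work)}
    (h : IsSwapped ψ f) (U : Ket QIn →L[ℂ] Ket QIn) :
    IsSwapped (RedOp.ask.apply A U ψ) (actOn (Equiv.prodComm QIn A.Work) U f) := by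
  intro a w b z
  change U (blockAt (splitAsk A Str) ψ ((a, w), z)) b =
    if _ then U (blockAt (Equiv.prodComm QIn A.Work) f w) b else 0
  split_ifs with h1
  · have : blockAt (splitAsk A Str) ψ ((a, w), z) =
        blockAt (Equiv.prodComm QIn A.Work) f w := by
      ext b'
      exact (h a w b' z).trans (if_pos h1)
    rw [this]
  · have : blockAt (splitAsk A Str) ψ ((a, w), z) = 0 := by
      ext b'
      exact (h a w b' z).trans (if_neg h1)
    rw [this, map_zero]
    rfl

theorem IsIdle.call {A : QAlg} {ψ : Ket (RedBasis A Str)} {f : Ket (QIn × A.Work)}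
    (h : IsIdle ψ f) (U : Ket QIn →L[ℂ] Ket QIn) {k : ℕ} (hk : k ≤ A.queries) :
    IsIdle ((RedOp.call k).apply A U ψ) (A.step k f) := by
  intro a c
  rw [RedOp.apply, if_pos hk]
  change A.step k (blockAt (Equiv.prodComm (QIn × A.Work) (QIn × Str)) ψ c) a = _
  split_ifs with h1
  · have : blockAt (Equiv.prodComm (QIn × A.Work) (QIn × Str)) ψ c = f := by
      ext a'
      exact (h a' c).trans (if_pos h1)
    rw [this]
  · have : blockAt (Equiv.prodComm (QIn × A.Work) (QIn × Str)) ψ c = 0 := by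
      ext a'
      exact (h a' c).trans (if_neg h1)
    rw [this, map_zero]
    rfl

/-- The operations that run the algorithm until just before its query number `i`. -/
noncomputable def simProg (m : ℕ) : ℕ → List (RedOp Str)
  | 0 => [.call 0]
  | i + 1 => simProg m i ++
      [.loc (permKet (boundedSwap m)), .ask, .loc (permKet (boundedSwap m)), .call (i + 1)]

/-- The state after the operations `l`. -/
noncomputable def runOps (A : QAlg) (U : Ket QIn →L[ℂ] Ket QIn) (l : List (RedOp Str)) :
    Ket (RedBasis A Str) :=
  l.foldl (fun ψ o => o.apply A U ψ) (ket ((([], none), A.work0), (([], none), [])))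

theorem runOps_append (A : QAlg) (U : Ket QIn →L[ℂ] Ket QIn) (l l' : List (RedOp Str)) :
    runOps A U (l ++ l') = l'.foldl (fun ψ o => o.apply A U ψ) (runOps A U l) :=
  List.foldl_append

theorem isIdle_ket (A : QAlg) :
    IsIdle (A := A) (ket ((([], none), A.work0), (([], none), [])))
      (ket (([], none), A.work0)) := by
  classical
  intro a c
  rw [ket_apply, ket_apply]
  by_cases h1 : c = (([], none), []) <;> by_cases h2 : a = (([], none), A.work0) <;>
    simp [h1, h2]

/-- After each simulated query the second swap returns the auxiliary registers to their initial
state, so they stay unentangled with the algorithm. -/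
theorem isIdle_simProg (A : QAlg) (O : Oracle) (m i : ℕ) (hi : i ≤ A.queries)
    (hA : ∀ j < i, ShortQuery m (A.state (colUnitary O) j)) :
    IsIdle (runOps A (colUnitary O) (simProg m i)) (A.state (colUnitary O) i) := by
  induction i with
  | zero => exact (isIdle_ket A).call (colUnitary O) (Nat.zero_le _)
  | succ i ih =>
    have h := ih (Nat.le_of_succ_le hi) fun j hj => hA j (hj.trans i.lt_succ_self)
    have hs := hA i i.lt_succ_self
    have hs' : ShortQuery m
        (actOn (Equiv.prodComm QIn A.Work) (colUnitary O) (A.state (colUnitary O) i)) :=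
      fun a w ha => actOn_colUnitary_eq_zero (Equiv.prodComm QIn A.Work) O _ m
        (fun k hk => hs k.1 k.2 hk) (a, w) ha
    rw [simProg, runOps_append]
    exact (((h.boundedSwap m hs (colUnitary O)).ask _).boundedSwap m hs' (colUnitary O)).call
      (colUnitary O) hi

/-- The description of the circuit that applies the first `k` gates of the circuit described by
`x` and outputs all wires. -/
noncomputable def prefixStr (m k : ℕ) (x : Str) : Str :=
  match Circuit.decode x with
  | none => []
  | some C => if (C.prefixAll k).encode.length ≤ m then (C.prefixAll k).encode else []

/-- The query made by gate number `k` of the circuit described by `x`, if the content of its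
wires is `y`. -/
noncomputable def gateQuery (k : ℕ) (x : Str) (y : Resp) : Str :=
  match Circuit.decode x with
  | none => []
  | some C => match C.gates[k]? with
    | some (.oracle ins _ _) => ins.map fun w : Fin (C.nA + C.nB) => (y.getD []).getD (w : ℕ) false
    | _ => []

/-- The operations that run the algorithm until just before query number `i`, and the circuit
that is queried until just before gate number `k`, and write down the query of that gate. -/
noncomputable def extractProg (m i k : ℕ) : List (RedOp Str) :=
  simProg m i ++ [.loc (permKet (writeQuery (prefixStr m k))), .ask,
    .loc (permKet (writeOut (gateQuery k)))]

theorem swap_nil_eq_nil_iff (s x : Str) : Equiv.swap [] s x = [] ↔ x = s := by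
  rw [Equiv.swap_apply_eq_iff, Equiv.swap_apply_left]

/-- The auxiliary response register holds `|⊥⟩`, so the query turns it into `|D_{g x}⟩`. The
registers of the algorithm act as controls only, and the amplitude is a product. -/
theorem extract_apply {A : QAlg} {ψ : Ket (RedBasis A Str)} {f : Ket (QIn × A.Work)}
    (h : IsIdle ψ f) (O : Oracle) (g : Str → Str) (F : Str → Resp → Str) (a : QIn) (w : A.Work)
    (x : Str) (y : Resp) (z : Str) :
    (RedOp.loc (permKet (writeOut F))).apply A (colUnitary O)
      (RedOp.ask.apply A (colUnitary O)
        ((RedOp.loc (permKet (writeQuery g))).apply A (colUnitary O) ψ)) ((a, w), ((x, y), z)) =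
      if x = g a.1 ∧ z = F a.1 y then f (a, w) * distKet (DCol O x) y else 0 := by
  set χ := (RedOp.loc (permKet (writeQuery g))).apply A (colUnitary O) ψ with hχ
  have hχ' : ∀ y' z', χ ((a, w), ((x, y'), z')) =
      if x = g a.1 ∧ y' = none ∧ z' = [] then f (a, w) else 0 := fun y' z' => by
    rw [hχ, apply_loc_permKet, writeQuery_symm_apply, h]
    simp only [Prod.ext_iff, swap_nil_eq_nil_iff, and_assoc]
  have hb : blockAt (splitResp (splitAsk A Str)) χ
      (((a, w), Equiv.swap [] (F a.1 y) z), x) =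
      (if x = g a.1 ∧ z = F a.1 y then f (a, w) else 0) • ket none := by
    ext y'
    have h0 := hχ' y' (Equiv.swap [] (F a.1 y) z)
    simp only [swap_nil_eq_nil_iff] at h0
    refine h0.trans ?_
    change _ = (if x = g a.1 ∧ z = F a.1 y then f (a, w) else 0) * ket none y'
    rw [ket_apply]
    by_cases h1 : x = g a.1 <;> by_cases h2 : y' = none <;> by_cases h3 : z = F a.1 y <;>
      simp [h1, h2, h3]
  change swapBot (distKet (DCol O x)) (blockAt (splitResp (splitAsk A Str)) χ
      (((a, w), Equiv.swap [] (F a.1 y) z), x)) y = _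
  rw [hb, map_smul, (isBotSplit_distKet O x).swapBot_bot]
  change (if x = g a.1 ∧ z = F a.1 y then f (a, w) else 0) * distKet (DCol O x) y = _
  rw [ite_mul, zero_mul]

/-- Strings that are longer than `m` are replaced by the empty string. -/
def truncOut (m : ℕ) (z : Str) : Str := if z.length ≤ m then z else []

/-- The truncated circuit outputs the wire contents `b` with probability equal to the squared
amplitude just before gate `k`, and `gateQuery` computes from `b` the string on the query wires. -/
theorem hitStr_le_tsum (O : Oracle) (T : Set Str) (m k : ℕ) (x : Str) (hx : x.length ≤ m) :
    hitStr O T x k ≤ ∑' y, {y | truncOut m (gateQuery k x y) ∈ T}.indicator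
      (fun y => ‖distKet (DCol O (prefixStr m k x)) y‖ ^ 2) y := by
  have h0 : 0 ≤ ∑' y, {y | truncOut m (gateQuery k x y) ∈ T}.indicator
      (fun y => ‖distKet (DCol O (prefixStr m k x)) y‖ ^ 2) y :=
    tsum_nonneg fun y => Set.indicator_nonneg (fun _ _ => sq_nonneg _) y
  cases hC : Circuit.decode x with
  | none => simpa only [hitStr, hC] using h0
  | some C =>
    cases hg : C.gates[k]? with
    | none => simpa only [hitStr, hC, hitProb, hg] using h0
    | some g =>
      by_cases ho : ∃ ins outs h, g = Gate.oracle ins outs h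
      · obtain ⟨ins, outs, h, rfl⟩ := ho
        simp only [hitStr, hC, hitProb, hg]
        have hlen : C.encode.length ≤ m := by rwa [Circuit.encode_of_decode hC]
        have hp : prefixStr m k x = (flatCircuit (C.gates.take k)).encode := by
          simp only [prefixStr, hC]
          exact if_pos ((C.length_encode_prefixAll_le k).trans hlen)
        -- The query wires are distinct and the wire count is written in unary, so the query is no
        -- longer than the description and `truncOut` leaves it intact.
        have hins : ins.length ≤ m := by
          have h1 := (List.nodup_append.1 h).1.length_le_card
          have h2 := C.length_encode
          rw [Fintype.card_fin] at h1
          omega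
        rw [hp, ← tsum_fintype (L := SummationFilter.unconditional _)]
        refine Summable.tsum_le_tsum_of_inj
          (fun b : Fin (C.nA + C.nB) → Bool => (some (List.ofFn b) : Resp))
          ((Option.some_injective _).comp List.ofFn_injective)
          (fun y _ => Set.indicator_nonneg (fun _ _ => sq_nonneg _) y) (fun b => ?_)
          (Summable.of_finite) ((ket_summable _).indicator _)
        have hq : gateQuery k x (some (List.ofFn b)) = ins.map b := by
          simp only [gateQuery, hC, hg, Option.getD_some]
          refine List.map_congr_left fun w _ => ?_
          rw [List.getD_eq_getElem _ _ (by simp)]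
          simp
        have ht : truncOut m (ins.map b) = ins.map b := if_pos (by simpa using hins)
        have hn : ‖distKet (DCol O (flatCircuit (C.gates.take k)).encode)
            (some (List.ofFn b))‖ = ‖runGates O (C.gates.take k) b‖ := by
          rw [distKet_DCol_flatCircuit_apply, Complex.norm_real, norm_norm]
        by_cases hb : ins.map b ∈ T
        · rw [Set.indicator_of_mem (show b ∈ (Gate.oracle ins outs h).queryIn T from hb),
            Set.indicator_of_mem (by
              change truncOut m (gateQuery k x (some (List.ofFn b))) ∈ T
              rwa [hq, ht]), hn]
        · rw [Set.indicator_of_notMem (show b ∉ (Gate.oracle ins outs h).queryIn T from hb)]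
          exact Set.indicator_nonneg (fun _ _ => sq_nonneg _) _
      · have e : g.queryIn T = ∅ := by
          cases g <;> first | rfl | exact absurd ⟨_, _, _, rfl⟩ ho
        simp only [hitStr, hC, hitProb, hg, e, Set.indicator_empty, Finset.sum_const_zero]
        exact h0

theorem tsum_hitStr_le_probIn (A : QAlg) (O : Oracle) (T : Set Str) (m i k : ℕ)
    (hi : i ≤ A.queries) (hA : ∀ j ≤ i, ShortQuery m (A.state (colUnitary O) j)) :
    ∑' a, hitStr O T a.1.1 k * ‖A.state (colUnitary O) i a‖ ^ 2 ≤
      probIn (runOps A (colUnitary O) (extractProg m i k)) {κ | truncOut m κ.2.2 ∈ T} := by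
  set f := A.state (colUnitary O) i with hf
  set ψ := runOps A (colUnitary O) (extractProg m i k) with hψ
  have hval : ∀ a w x y z, ψ ((a, w), ((x, y), z)) =
      if x = prefixStr m k a.1 ∧ z = gateQuery k a.1 y then f (a, w) * distKet (DCol O x) y
      else 0 := fun a w x y z => by
    rw [hψ, extractProg, runOps_append]
    exact extract_apply (isIdle_simProg A O m i hi fun j hj => hA j hj.le) O _ _ a w x y z
  -- The basis states that can carry amplitude after extraction, parametrized by the state of the
  -- algorithm and the measured response; on them the probability factorizes.
  let ι : (QIn × A.Work) × Resp → RedBasis A Str := fun p =>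
    (p.1, ((prefixStr m k p.1.1.1, p.2), gateQuery k p.1.1.1 p.2))
  have hι : Function.Injective ι := by
    rintro ⟨a, y⟩ ⟨a', y'⟩ h
    have h1 := (Prod.ext_iff.1 h).1
    have h2 := (Prod.ext_iff.1 (Prod.ext_iff.1 (Prod.ext_iff.1 h).2).1).2
    exact Prod.ext h1 h2
  have hs : Summable fun κ => {κ : RedBasis A Str | truncOut m κ.2.2 ∈ T}.indicator
      (fun κ => ‖ψ κ‖ ^ 2) κ := (ket_summable ψ).indicator _
  have hsι := hs.comp_injective hι
  have h1 : ∑' p, {κ : RedBasis A Str | truncOut m κ.2.2 ∈ T}.indicator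
      (fun κ => ‖ψ κ‖ ^ 2) (ι p) ≤ probIn ψ {κ | truncOut m κ.2.2 ∈ T} :=
    Summable.tsum_le_tsum_of_inj ι hι
      (fun κ _ => Set.indicator_nonneg (fun _ _ => sq_nonneg _) κ) (fun _ => le_rfl) hsι hs
  refine le_trans ?_ h1
  have h2 := hsι.tsum_prod
  simp only [Function.comp_def] at h2
  rw [h2]
  refine (summable_weight f (fun a => hitStr O T a.1.1 k) 1 (fun _ => hitStr_nonneg _ _ _ _)
    (fun _ => hitStr_le_one _ _ _ _)).tsum_le_tsum (fun a => ?_) hsι.prod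
  have h3 : ∀ y, {κ : RedBasis A Str | truncOut m κ.2.2 ∈ T}.indicator
      (fun κ => ‖ψ κ‖ ^ 2) (ι (a, y)) = ‖f a‖ ^ 2 *
        {y | truncOut m (gateQuery k a.1.1 y) ∈ T}.indicator
          (fun y => ‖distKet (DCol O (prefixStr m k a.1.1)) y‖ ^ 2) y := fun y => by
    have hv : ψ (ι (a, y)) = f a * distKet (DCol O (prefixStr m k a.1.1)) y :=
      (hval a.1 a.2 _ y _).trans (if_pos ⟨rfl, rfl⟩)
    by_cases hy : truncOut m (gateQuery k a.1.1 y) ∈ T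
    · rw [Set.indicator_of_mem (show ι (a, y) ∈ {κ : RedBasis A Str | truncOut m κ.2.2 ∈ T}
          from hy), Set.indicator_of_mem (by exact hy), hv, norm_mul, mul_pow]
    · rw [Set.indicator_of_notMem (show ι (a, y) ∉ {κ : RedBasis A Str | truncOut m κ.2.2 ∈ T}
          from hy), Set.indicator_of_notMem (by exact hy), mul_zero]
  rw [tsum_congr h3, tsum_mul_left, mul_comm]
  by_cases ha : m < a.1.1.length
  · have : f a = 0 := hA i le_rfl a.1 a.2 ha
    simp [this]
  · exact mul_le_mul_of_nonneg_left (hitStr_le_tsum O T m k a.1.1 (not_lt.1 ha)) (sq_nonneg _)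

/-! ### The query complexity of the extractor -/

theorem countP_simProg (m i : ℕ) : (simProg m i).countP RedOp.isQuery = 2 * i + 1 := by
  induction i with
  | zero => rfl
  | succ i ih =>
    rw [simProg, List.countP_append, ih]
    simp [List.countP_cons, RedOp.isQuery]
    ring

/-- `i + 1` calls of the algorithm, `i` simulated oracle queries and one query for the extraction.
-/
theorem countP_extractProg (m i k : ℕ) :
    (extractProg m i k).countP RedOp.isQuery = 2 * i + 2 := by
  rw [extractProg, List.countP_append, countP_simProg]
  simp [List.countP_cons, RedOp.isQuery]

/-- One's own query strings have length at most `m`. -/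
def ShortAsk {A : QAlg} (m : ℕ) (ψ : Ket (RedBasis A Str)) : Prop :=
  ∀ k, m < k.2.1.1.length → ψ k = 0

/-- The operation keeps the bound on the lengths of one's own query strings. -/
def RedOp.KeepsShort (A : QAlg) (O : Oracle) (m : ℕ) (o : RedOp Str) : Prop :=
  ∀ ψ : Ket (RedBasis A Str), ShortAsk m ψ → ShortAsk m (o.apply A (colUnitary O) ψ)

theorem keepsShort_call (A : QAlg) (O : Oracle) (m k : ℕ) :
    RedOp.KeepsShort A O m (.call k) := by
  intro ψ h c hc
  rw [RedOp.apply]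
  split_ifs
  · have : blockAt (Equiv.prodComm (QIn × A.Work) (QIn × Str)) ψ c.2 = 0 := by
      ext a
      exact h (a, c.2) hc
    change A.step k (blockAt (Equiv.prodComm (QIn × A.Work) (QIn × Str)) ψ c.2) c.1 = 0
    rw [this, map_zero]
    rfl
  · exact h c hc

theorem keepsShort_ask (A : QAlg) (O : Oracle) (m : ℕ) : RedOp.KeepsShort A O m .ask :=
  fun ψ h c hc => actOn_colUnitary_eq_zero (splitAsk A Str) O ψ m h c hc

theorem keepsShort_loc (A : QAlg) (O : Oracle) (m : ℕ) (σ : Equiv.Perm (QIn × (QIn × Str)))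
    (hσ : ∀ k, m < k.2.1.1.length → m < (σ.symm k).2.1.1.length) :
    RedOp.KeepsShort A O m (.loc (permKet σ)) :=
  fun _ h c hc => h (((σ.symm (c.1.1, c.2)).1, c.1.2), (σ.symm (c.1.1, c.2)).2)
    (hσ (c.1.1, c.2) hc)

/-- A basis state with a long auxiliary query is fixed by the swap, so it gains no amplitude. The
condition in `boundedSwap` makes the length bound hold for every algorithm, even one with long
queries. -/
theorem keepsShort_boundedSwap (A : QAlg) (O : Oracle) (m : ℕ) :
    RedOp.KeepsShort A O m (.loc (permKet (boundedSwap m))) :=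
  keepsShort_loc A O m _ fun ⟨a, b, z⟩ hk => by
    rwa [boundedSwap_symm_apply_of_not_le z fun h => (not_lt.2 h.2) hk]

theorem keepsShort_writeQuery (A : QAlg) (O : Oracle) (m : ℕ) (g : Str → Str)
    (hg : ∀ x, (g x).length ≤ m) :
    RedOp.KeepsShort A O m (.loc (permKet (writeQuery g))) :=
  keepsShort_loc A O m _ fun ⟨a, (x, y), z⟩ hk => by
    rw [writeQuery_symm_apply, Equiv.swap_apply_of_ne_of_ne]
    · exact hk
    · rintro rfl
      simp at hk
    · rintro rfl
      exact absurd hk (not_lt.2 (hg a.1))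

theorem keepsShort_writeOut (A : QAlg) (O : Oracle) (m : ℕ) (F : Str → Resp → Str) :
    RedOp.KeepsShort A O m (.loc (permKet (writeOut F))) :=
  keepsShort_loc A O m _ fun _ hk => hk

theorem length_prefixStr_le (m k : ℕ) (x : Str) : (prefixStr m k x).length ≤ m := by
  unfold prefixStr
  split
  · simp
  · split_ifs with h
    · exact h
    · simp

theorem keepsShort_simProg (A : QAlg) (O : Oracle) (m i : ℕ) :
    ∀ o ∈ simProg m i, RedOp.KeepsShort A O m o := by
  induction i with
  | zero =>
    intro o ho
    rw [simProg, List.mem_singleton] at ho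
    exact ho ▸ keepsShort_call A O m 0
  | succ i ih =>
    intro o ho
    rw [simProg, List.mem_append] at ho
    rcases ho with ho | ho
    · exact ih o ho
    · simp only [List.mem_cons, List.not_mem_nil, or_false] at ho
      rcases ho with rfl | rfl | rfl | rfl
      · exact keepsShort_boundedSwap A O m
      · exact keepsShort_ask A O m
      · exact keepsShort_boundedSwap A O m
      · exact keepsShort_call A O m _

theorem keepsShort_extractProg (A : QAlg) (O : Oracle) (m i k : ℕ) :
    ∀ o ∈ extractProg m i k, RedOp.KeepsShort A O m o := by
  intro o ho
  rw [extractProg, List.mem_append] at ho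
  rcases ho with ho | ho
  · exact keepsShort_simProg A O m i o ho
  · simp only [List.mem_cons, List.not_mem_nil, or_false] at ho
    rcases ho with rfl | rfl | rfl
    · exact keepsShort_writeQuery A O m _ (length_prefixStr_le m k)
    · exact keepsShort_ask A O m
    · exact keepsShort_writeOut A O m _

theorem shortAsk_runOps (A : QAlg) (O : Oracle) (m : ℕ) (l : List (RedOp Str))
    (hl : ∀ o ∈ l, RedOp.KeepsShort A O m o) : ShortAsk m (runOps A (colUnitary O) l) := by
  induction l using List.reverseRecOn with
  | nil =>
    classical
    intro k hk
    change (ket ((([], none), A.work0), (([], none), [])) : Ket (RedBasis A Str)) k = 0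
    rw [ket_apply, if_neg]
    rintro rfl
    simp at hk
  | append_singleton l o ih =>
    rw [runOps_append]
    exact hl o (by simp) _ (ih fun o' ho' => hl o' (by simp [ho']))

/-! ### The extractor -/

/-- The pairs of numbers at most `q`, coded as numbers. -/
def pairCodes (q : ℕ) : Finset ℕ :=
  (Finset.range (q + 1) ×ˢ Finset.range (q + 1)).map Nat.pairEquiv.toEmbedding

theorem pairCodes_nonempty (q : ℕ) : (pairCodes q).Nonempty := by
  simp [pairCodes]

/-- Chooses a query of the algorithm and a gate, and extracts the query of that gate. -/
noncomputable def extractor (q : ℕ) : Reduction where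
  Work := Str
  work0 := []
  coin := PMF.uniformOfFinset (pairCodes q) (pairCodes_nonempty q)
  -- The query bound is required for every `r`, also for those of probability 0; the minimum
  -- enforces it there and changes nothing on `pairCodes q`.
  prog r := extractProg q (min r.unpair.1 q) r.unpair.2
  out := truncOut q

theorem length_truncOut_le (m : ℕ) (z : Str) : (truncOut m z).length ≤ m := by
  unfold truncOut
  split_ifs with h
  · exact h
  · exact Nat.zero_le m

theorem extractor_isQuery (A : QAlg) (O : Oracle) (q : ℕ) :
    (extractor q).IsQuery A (colUnitary O) (2 * q + 2) := by
  refine ⟨fun r => ?_, fun r l l' hl a x y z hx => ?_, fun z => ?_⟩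
  · have := min_le_right r.unpair.1 q
    refine (countP_extractProg _ _ _).trans_le ?_
    omega
  · refine shortAsk_runOps A O q l (fun o ho => ?_) (a, ((x, y), z)) ?_
    · have h : o ∈ (extractor q).prog r := hl ▸ List.mem_append_left _ ho
      exact keepsShort_extractProg A O q _ _ o h
    · change q < x.length
      omega
  · exact (length_truncOut_le q z).trans (by omega)

theorem probIn_nonneg {κ : Type} (ψ : Ket κ) (S : Set κ) : 0 ≤ probIn ψ S :=
  tsum_nonneg fun k => Set.indicator_nonneg (fun _ _ => sq_nonneg _) k

theorem probOut_extractor (A : QAlg) (U : Ket QIn →L[ℂ] Ket QIn) (T : Set Str) (q : ℕ) :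
    (extractor q).probOut A U T = ((q + 1 : ℝ) ^ 2)⁻¹ * ∑ i ∈ Finset.range (q + 1),
      ∑ k ∈ Finset.range (q + 1),
        probIn (runOps A U (extractProg q i k)) {κ | truncOut q κ.2.2 ∈ T} := by
  have hc : ∀ r, ((extractor q).coin r).toReal =
      if r ∈ pairCodes q then ((q + 1 : ℝ) ^ 2)⁻¹ else 0 := fun r => by
    change (PMF.uniformOfFinset (pairCodes q) (pairCodes_nonempty q) r).toReal = _
    rw [PMF.uniformOfFinset_apply]
    split_ifs
    · rw [pairCodes, Finset.card_map, Finset.card_product, Finset.card_range, ENNReal.toReal_inv]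
      push_cast
      rw [sq]
      norm_cast
    · rfl
  rw [Reduction.probOut, tsum_eq_sum (s := pairCodes q) fun r hr => by rw [hc, if_neg hr, zero_mul],
    pairCodes, Finset.sum_map, Finset.sum_product, Finset.mul_sum]
  refine Finset.sum_congr rfl fun i hi => ?_
  rw [Finset.mul_sum]
  refine Finset.sum_congr rfl fun k hk => ?_
  have hr : Nat.pairEquiv.toEmbedding (i, k) ∈ pairCodes q :=
    Finset.mem_map_of_mem _ (Finset.mem_product.2 ⟨hi, hk⟩)
  have hp : (extractor q).prog (Nat.pairEquiv.toEmbedding (i, k)) = extractProg q i k := by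
    change extractProg q (min (Nat.pair i k).unpair.1 q) (Nat.pair i k).unpair.2 = _
    rw [Nat.unpair_pair, min_eq_left (Nat.lt_succ_iff.1 (Finset.mem_range.1 hi))]
  rw [hc, if_pos hr, hp]
  rfl

theorem probOut_extractor_nonneg (A : QAlg) (U : Ket QIn →L[ℂ] Ket QIn) (T : Set Str) (q : ℕ) :
    0 ≤ (extractor q).probOut A U T := by
  rw [probOut_extractor]
  exact mul_nonneg (by positivity)
    (Finset.sum_nonneg fun _ _ => Finset.sum_nonneg fun _ _ => probIn_nonneg _ _)

theorem norm_sq_final_sub_le_probOut (A : QAlg) (O O' : Oracle) (q : ℕ) (hq : A.queries ≤ q)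
    (hA : ∀ i < A.queries, ∀ (x : Str) (y : Resp) (z : A.Work),
      q < x.length → A.state (colUnitary O) i ((x, y), z) = 0) :
    ‖A.final (colUnitary O) - A.final (colUnitary O')‖ ^ 2 ≤ 64 * q ^ 2 * ((q + 1) ^ 2 *
      (extractor q).probOut A (colUnitary O) {x | O x ≠ O' x}) := by
  refine (A.norm_sq_final_sub_le O O' q hq hA).trans
    (mul_le_mul_of_nonneg_left ?_ (by positivity))
  rw [probOut_extractor, ← mul_assoc, mul_inv_cancel₀ (by positivity), one_mul]
  -- The guesses that match no query, and the guess `k = q`, contribute nonnegative terms that are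
  -- dropped; the range `q + 1` keeps the coin set nonempty for `q = 0`.
  have hsub : Finset.range A.queries ⊆ Finset.range (q + 1) :=
    Finset.range_subset_range.2 (by omega)
  refine le_trans (Finset.sum_le_sum fun i hi => ?_)
    (Finset.sum_le_sum_of_subset_of_nonneg hsub
      fun _ _ _ => Finset.sum_nonneg fun _ _ => probIn_nonneg _ _)
  have hi' := Finset.mem_range.1 hi
  refine le_trans (Finset.sum_le_sum fun k _ => ?_)
    (Finset.sum_le_sum_of_subset_of_nonneg (Finset.range_subset_range.2 q.le_succ)
      fun _ _ _ => probIn_nonneg _ _)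
  exact tsum_hitStr_le_probIn A O _ q i k hi'.le
    fun j hj a w ha => hA j (hj.trans_lt hi') a.1 a.2 w ha

theorem norm_final_sub_le (A : QAlg) (O O' : Oracle) (q : ℕ) (hq : A.queries ≤ q)
    (hA : ∀ i < A.queries, ∀ (x : Str) (y : Resp) (z : A.Work),
      q < x.length → A.state (colUnitary O) i ((x, y), z) = 0) :
    ‖A.final (colUnitary O) - A.final (colUnitary O')‖ ≤ 4 * Real.sqrt 6 * (q : ℝ) ^ (5 / 4 : ℝ) *
      (extractor q).probOut A (colUnitary O) {x | O x ≠ O' x} ^ (1 / 4 : ℝ) := by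
  set D := ‖A.final (colUnitary O) - A.final (colUnitary O')‖ with hD
  set P := (extractor q).probOut A (colUnitary O) {x | O x ≠ O' x} with hP
  have hP0 : 0 ≤ P := probOut_extractor_nonneg _ _ _ _
  have hD0 : 0 ≤ D := norm_nonneg _
  have h1 : D ^ 2 ≤ 64 * q ^ 2 * ((q + 1) ^ 2 * P) := norm_sq_final_sub_le_probOut A O O' q hq hA
  -- Two unit vectors are at distance at most 2; this trades the exponent 1/2 for 1/4 through `D⁴ ≤
  -- 4 D²`.
  have h2 : D ≤ 2 := by
    refine (norm_sub_le _ _).trans_eq ?_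
    rw [QAlg.final, QAlg.final, QAlg.norm_state, QAlg.norm_state]
    norm_num
  refine le_of_pow_le_pow_left₀ (n := 4) (by norm_num) (by positivity) ?_
  have e1 : ((q : ℝ) ^ (5 / 4 : ℝ)) ^ 4 = (q : ℝ) ^ 5 := by
    rw [← Real.rpow_mul_natCast (Nat.cast_nonneg q), ← Real.rpow_natCast]
    norm_num
  have e2 : (P ^ (1 / 4 : ℝ)) ^ 4 = P := by
    rw [← Real.rpow_mul_natCast hP0]
    norm_num
  have e3 : Real.sqrt 6 ^ 4 = 36 := by
    have h := Real.sq_sqrt (show (0 : ℝ) ≤ 6 by norm_num)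
    calc Real.sqrt 6 ^ 4 = (Real.sqrt 6 ^ 2) ^ 2 := by ring
      _ = 36 := by rw [h]; norm_num
  rw [mul_pow, mul_pow, mul_pow, e1, e2, e3]
  have h3 : D ^ 4 ≤ 4 * D ^ 2 := by
    have : D ^ 2 ≤ 4 := by nlinarith
    nlinarith [mul_le_mul_of_nonneg_right this (sq_nonneg D)]
  -- For `q = 0` the bound forces `D = 0`; otherwise `q + 1 ≤ 2 q`.
  rcases Nat.eq_zero_or_pos q with h0 | h0
  · rw [h0] at h1 ⊢
    norm_num at h1 ⊢
    nlinarith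
  · have hq1 : (1 : ℝ) ≤ q := by exact_mod_cast h0
    have h4 : ((q : ℝ) + 1) ^ 2 ≤ 4 * (q : ℝ) ^ 2 := by nlinarith
    have h5 : (q : ℝ) ^ 4 ≤ (q : ℝ) ^ 5 := pow_le_pow_right₀ hq1 (by norm_num)
    calc D ^ 4 ≤ 4 * D ^ 2 := h3
      _ ≤ 4 * (64 * q ^ 2 * ((q + 1) ^ 2 * P)) := by linarith
      _ ≤ 4 * (64 * q ^ 2 * (4 * q ^ 2 * P)) := by gcongr
      _ = 1024 * (q : ℝ) ^ 4 * P := by ring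
      -- `9216 = (4√6)⁴`; the chain has room to spare both here and in the power of `q`.
      _ ≤ 9216 * (q : ℝ) ^ 5 * P := by
        refine mul_le_mul_of_nonneg_right ?_ hP0
        nlinarith [pow_nonneg (Nat.cast_nonneg q : (0 : ℝ) ≤ q) 5]
      _ = _ := by ring

theorem colUnitary_ow2hBound (𝕆 : Set Oracle) (P : ℕ → ℝ)
    (hP : ∀ q : ℕ, 4 * Real.sqrt 6 * (q : ℝ) ^ (5 / 4 : ℝ) ≤ P q) :
    OW2HBound 𝕆 colUnitary (1 / 4) P := by
  refine ⟨2 * Polynomial.X + 2, fun q => ⟨fun n => extractor (q n),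
    fun A hA O hO O' _ n => ⟨?_, ?_⟩⟩⟩
  · have h : (2 * Polynomial.X + 2 : Polynomial ℕ).eval (q n) = 2 * q n + 2 := by simp
    rw [h]
    exact extractor_isQuery (A n) O (q n)
  · refine (norm_final_sub_le (A n) O O' (q n) (hA n).1
      ((hA n).2 _ (Set.mem_image_of_mem _ hO))).trans ?_
    exact mul_le_mul_of_nonneg_right (hP _)
      (Real.rpow_nonneg (probOut_extractor_nonneg _ _ _ _) _)

/-- Compatibility asks for a polynomial factor, and `q^{5/4}` is not one; `10 q²` dominates it. -/
theorem four_sqrt_six_mul_rpow_le (q : ℕ) :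
    4 * Real.sqrt 6 * (q : ℝ) ^ (5 / 4 : ℝ) ≤ 10 * (q : ℝ) ^ 2 := by
  have h1 : Real.sqrt 6 ≤ 5 / 2 := Real.sqrt_le_iff.2 ⟨by norm_num, by norm_num⟩
  have h2 : (q : ℝ) ^ (5 / 4 : ℝ) ≤ (q : ℝ) ^ 2 := by
    rcases Nat.eq_zero_or_pos q with rfl | h0
    · rw [Nat.cast_zero, Real.zero_rpow (by norm_num)]
      norm_num
    · rw [← Real.rpow_natCast]
      exact Real.rpow_le_rpow_of_exponent_le (by exact_mod_cast h0) (by norm_num)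
  exact mul_le_mul (by linarith) h2 (by positivity) (by norm_num)

theorem mainTheorem8 (𝕆 : Set Oracle) (h𝕆 : ∀ x : Str, ∃ m : ℕ, ∀ O ∈ 𝕆, (O x).length ≤ m) :
    IsOW2HCompatible 𝕆 colUnitary (1 / 4) ∧
      OW2HBound 𝕆 colUnitary (1 / 4)
        (fun n => 4 * Real.sqrt 6 * (n : ℝ) ^ (5 / 4 : ℝ)) := by
  refine ⟨⟨fun O _ => colUnitary_mem_unitary O, colUnitary_computes 𝕆 h𝕆,
    10 * Polynomial.X ^ 2, colUnitary_ow2hBound 𝕆 _ fun q => ?_⟩,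
    colUnitary_ow2hBound 𝕆 _ fun _ => le_rfl⟩
  have h : (10 * Polynomial.X ^ 2 : Polynomial ℝ).eval (q : ℝ) = 10 * (q : ℝ) ^ 2 := by simp
  rw [h]
  exact four_sqrt_six_mul_rpow_le q
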